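/- For a positive integer $n$, let $Q_n$ be a random $n\times n$ matrix whose rows are independent and each uniformly distributed on the set of vectors in $\{0,1\}^n$ with coordinate sum exactly $\lfloor n/2\rfloor$. For $\delta,\rho\in(0,1)$, let $\operatorname{Cons}(\delta,\rho)\subset\mathbb{R}^n$ be the set of vectors $x$ with $\|x\|_2=1$ for which there is some $\lambda\in\mathbb{R}$ such that $|x_i-\lambda|\le \rho/\sqrt n$ for at least $(1-\delta)n$ indices $i\in\{1,\dots,n\}$. For every $\epsilon>0$ there exist $\delta,\rho\in(0,1)$, $c>0$ and $n_0\in\mathbb{N}$, depending only on $\epsilon$, such that for all $n\ge n_0$, $$\mathbb{P}\Big[\inf_{x\in\operatorname{Cons}(\delta,\rho)}\|Q_nx\|_2\le c\sqrt n\ \text{ or }\ \inf_{y\in\operatorname{Cons}(\delta,\rho)}\|yQ_n\|_2\le c\sqrt n\Big]\le\Big(\frac12+\epsilon\Big)^n,$$ where in $Q_nx$ the vector $x$ is a column vector and in $yQ_n$ the vector $y$ is a row vector. -/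

import Mathlib

open MeasureTheory ProbabilityTheory
open scoped Matrix

noncomputable section

/-- The slice of the Boolean cube: the vectors in `{0,1}^n` with coordinate sum exactly `m`. -/
def booleanSlice (n m : ℕ) : Set (Fin n → ℝ) :=
  {q | (∀ j, q j = 0 ∨ q j = 1) ∧ ∑ j, q j = (m : ℝ)}

/-- The law of the random `n × n` matrix with independent rows, each uniformly distributed on the
vectors in `{0,1}^n` with sum `⌊n/2⌋`. A matrix is given by its family of rows `i ↦ (j ↦ Q i j)`. -/
def rowSliceLaw (n : ℕ) : Measure (Fin n → Fin n → ℝ) :=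
  Measure.pi fun _ : Fin n => uniformOn (booleanSlice n (n / 2))

/-- The almost-constant vectors: the Euclidean unit vectors `x` in `ℝ^n` such that, for some real
`a`, at least `(1 - δ) n` coordinates of `x` satisfy `|x i - a| ≤ ρ / √n`. -/
def almostConstant (n : ℕ) (δ ρ : ℝ) : Set (EuclideanSpace ℝ (Fin n)) :=
  {x | ‖x‖ = 1 ∧ ∃ a : ℝ,
    (1 - δ) * (n : ℝ) ≤ (({i : Fin n | |x i - a| ≤ ρ / √(n : ℝ)} : Set (Fin n)).ncard : ℝ)}

/-- The Euclidean norm of the column vector `A x`. -/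
def mulVecNorm {n : ℕ} (A : Matrix (Fin n) (Fin n) ℝ) (x : EuclideanSpace ℝ (Fin n)) : ℝ :=
  ‖WithLp.toLp 2 (A *ᵥ x.ofLp)‖

/-- The Euclidean norm of the row vector `y A`. -/
def vecMulNorm {n : ℕ} (A : Matrix (Fin n) (Fin n) ℝ) (y : EuclideanSpace ℝ (Fin n)) : ℝ :=
  ‖WithLp.toLp 2 (y.ofLp ᵥ* A)‖

end

/-!
Write the random matrix as `Q = L + J / 2`, where `J` is the all-ones matrix and `L` has entries
`±1 / 2`. The constant `1 / 2` comes from vectors such as `(e₁ - e₂) / √2`: a linear form in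
independent bits whose coefficients have square sum bounded below is within a small distance of any
given point with probability at most `1 / 2 + ε` (`exists_sum_exp_neg_sq_le`). Indeed, either one
coefficient is large, and its bit alone decides, or all coefficients are small, and then the
characteristic function of the form is Gaussian on a long interval.

The entries of `Q` are not independent within a row, but a row restricted to `k` columns has density
at most `√((n + 1) / (n - k))` with respect to independent bits (`sum_slice_restrict_le`). There are
three uses. With half of the columns the density is at most `2` per row, which is harmless for upper
tails: off an event of probability far below `2⁻ⁿ`, the matrix `L` is bounded by `6 √n` on all
vectors with entries in `{-1, 0, 1}` (`card_not_signBounded_le`). For a column vector supported on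
`γ n` coordinates, only these columns matter, and the total loss over all rows is `exp (O(γ n))`
(`card_mulVec_small_le`). For a row vector `y`, the columns of `Q` are not independent; all the rows
are frozen except the `γ n` rows in the support of the sparse part of `y`, and all but `β n` columns
are kept, so that the density is paid only `γ n` times, with `γ` much smaller than `β`
(`card_vecMul_small_le`).

An almost constant vector is `a + u + v` with `a` constant, `u` sparse and `v` uniformly small. The
part `v` lies in a small cube, and a convex function on a cube is largest at a vertex, so the bound
on `{-1, 0, 1}` vectors controls the contribution of `v` as well as the error of rounding `u` to a
lattice (`SignBounded.euclNorm_mulVec_le`). The mean part `(∑ i, x i) / 2` and `a` are rounded too.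
What remains is a net of polynomial size times `exp (O(σ n))` with `σ` small
(`exists_netVector`, `card_integerBall_le`), and the sparse part of its points is bounded below:
otherwise the vector is nearly a multiple of the all-ones vector, whose image has norm of order `n`
(`sum_sq_sparse_ge`). The union bound over the net finishes the proof
(`card_nearlySingular_le`).

Probabilities are handled as cardinalities of sets of Boolean matrices until the last step.
-/

/-! ### Independent centred bits -/

/-- The centred bit: `1/2` for `true` and `-1/2` for `false`. -/
noncomputable def halfSign (b : Bool) : ℝ := if b then 1 / 2 else -1 / 2

lemma halfSign_sq (b : Bool) : halfSign b ^ 2 = 1 / 4 := by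
  cases b <;> norm_num [halfSign]

lemma abs_halfSign (b : Bool) : |halfSign b| = 1 / 2 := by
  cases b <;> norm_num [halfSign]

/-- Sums over the cube of products factor over the coordinates. -/
lemma sum_prod_bool {R : Type*} [CommSemiring R] {ι : Type*} [Fintype ι] [DecidableEq ι]
    (f : ι → Bool → R) :
    ∑ z : ι → Bool, ∏ i, f i (z i) = ∏ i, (f i true + f i false) := by
  have h := (Finset.prod_univ_sum (fun _ : ι => (Finset.univ : Finset Bool)) f).symm
  rw [Fintype.piFinset_univ] at h
  simpa using h

/-! ### Gaussian integrals -/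

lemma integrable_gaussianReal_exp_neg_sq {b : ℝ} (hb : -1 / 2 < b) :
    Integrable (fun x : ℝ => Real.exp (-b * x ^ 2)) (gaussianReal 0 1) ∧
      ∫ x, Real.exp (-b * x ^ 2) ∂gaussianReal 0 1 = √(1 / (1 + 2 * b)) := by
  have hpdf : ∀ x : ℝ, gaussianPDFReal 0 1 x * Real.exp (-b * x ^ 2) =
      (√(2 * Real.pi))⁻¹ * Real.exp (-(b + 1 / 2) * x ^ 2) := by
    intro x
    rw [gaussianPDFReal_def]
    simp only [NNReal.coe_one, mul_one, sub_zero]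
    rw [mul_assoc, ← Real.exp_add]
    congr 2
    ring
  constructor
  · rw [gaussianReal_of_var_ne_zero _ one_ne_zero,
      integrable_withDensity_iff (measurable_gaussianPDF 0 1)
        (Filter.Eventually.of_forall fun x => gaussianPDF_lt_top)]
    have : (fun x : ℝ => Real.exp (-b * x ^ 2) * (gaussianPDF 0 1 x).toReal) =
        fun x => (√(2 * Real.pi))⁻¹ * Real.exp (-(b + 1 / 2) * x ^ 2) := by
      funext x
      rw [toReal_gaussianPDF, mul_comm, hpdf]
    rw [this]
    exact (integrable_exp_neg_mul_sq (by linarith)).const_mul _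
  · rw [integral_gaussianReal_eq_integral_smul one_ne_zero]
    simp only [smul_eq_mul, hpdf]
    rw [integral_const_mul, integral_gaussian, ← Real.sqrt_inv, ← Real.sqrt_mul (by positivity)]
    congr 1
    have : b + 1 / 2 ≠ 0 := by linarith
    have h2 : 1 + 2 * b ≠ 0 := by intro h; apply this; linarith
    rw [show Real.pi / (b + 1 / 2) = 2 * Real.pi * (1 / (1 + 2 * b)) by field_simp; ring]
    rw [inv_mul_cancel_left₀ (by positivity)]

/-- The Gaussian linearization of `exp (y ^ 2)`. -/
lemma integral_exp_sqrt_mul (y : ℝ) :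
    ∫ g, Real.exp (√2 * y * g) ∂gaussianReal 0 1 = Real.exp (y ^ 2) := by
  have h := congrFun (mgf_id_gaussianReal (μ := 0) (v := 1)) (√2 * y)
  simp only [mgf, id] at h
  rw [h]
  congr 1
  simp only [zero_mul, NNReal.coe_one, mul_pow]
  rw [Real.sq_sqrt (by norm_num)]
  ring

/-- Subgaussian square-exponential moment of a linear form in independent centred bits. -/
lemma sum_exp_sq_linearForm_le {ι : Type*} [Fintype ι] [DecidableEq ι] (w : ι → ℝ) {s : ℝ}
    (hs : 0 ≤ s) (hw : s * ∑ i, w i ^ 2 ≤ 1) :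
    ∑ z : ι → Bool, Real.exp (s * (∑ i, w i * halfSign (z i)) ^ 2) ≤
      2 * 2 ^ Fintype.card ι := by
  have h1 : ∀ z : ι → Bool, Real.exp (s * (∑ i, w i * halfSign (z i)) ^ 2) =
      ∫ g, Real.exp (√2 * (√s * ∑ i, w i * halfSign (z i)) * g) ∂gaussianReal 0 1 := by
    intro z
    rw [integral_exp_sqrt_mul, mul_pow, Real.sq_sqrt hs]
  simp only [h1]
  rw [← integral_finsetSum _ fun z _ => integrable_exp_mul_gaussianReal _]
  have h2 : ∀ g : ℝ, ∑ z : ι → Bool, Real.exp (√2 * (√s * ∑ i, w i * halfSign (z i)) * g) ≤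
      2 ^ Fintype.card ι * Real.exp (-(-1 / 4) * g ^ 2) := by
    intro g
    have : ∀ z : ι → Bool, Real.exp (√2 * (√s * ∑ i, w i * halfSign (z i)) * g) =
        ∏ i, Real.exp (√2 * √s * g * w i * halfSign (z i)) := by
      intro z
      rw [← Real.exp_sum]
      congr 1
      rw [Finset.mul_sum, Finset.mul_sum, Finset.sum_mul]
      exact Finset.sum_congr rfl fun i _ => by ring
    simp only [this]
    rw [sum_prod_bool fun i b => Real.exp (√2 * √s * g * w i * halfSign b)]
    have hb : ∀ i ∈ Finset.univ, Real.exp (√2 * √s * g * w i * halfSign true) +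
        Real.exp (√2 * √s * g * w i * halfSign false) ≤
        2 * Real.exp (s * w i ^ 2 * (g ^ 2 / 4)) := by
      intro i _
      have hc := Real.cosh_le_exp_half_sq (√2 * √s * g * w i / 2)
      rw [Real.cosh_eq] at hc
      have e : (√2 * √s * g * w i / 2) ^ 2 / 2 = s * w i ^ 2 * (g ^ 2 / 4) := by
        rw [div_pow, mul_pow, mul_pow, mul_pow, Real.sq_sqrt hs, Real.sq_sqrt (by norm_num)]
        ring
      rw [e] at hc
      have e1 : √2 * √s * g * w i * halfSign true = √2 * √s * g * w i / 2 := by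
        norm_num [halfSign]; ring
      have e2 : √2 * √s * g * w i * halfSign false = -(√2 * √s * g * w i / 2) := by
        norm_num [halfSign]; ring
      rw [e1, e2]
      linarith
    refine (Finset.prod_le_prod (fun i _ => by positivity) hb).trans ?_
    rw [Finset.prod_mul_distrib, Finset.prod_const, Finset.card_univ, ← Real.exp_sum,
      ← Finset.sum_mul, ← Finset.mul_sum]
    refine mul_le_mul_of_nonneg_left (Real.exp_le_exp.2 ?_) (by positivity)
    nlinarith [sq_nonneg g]
  obtain ⟨hi, hv⟩ := integrable_gaussianReal_exp_neg_sq (b := -1 / 4) (by norm_num)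
  refine (integral_mono (integrable_finsetSum _ fun z _ => integrable_exp_mul_gaussianReal _)
    (hi.const_mul _) h2).trans ?_
  rw [integral_const_mul, hv, mul_comm]
  refine mul_le_mul_of_nonneg_right ?_ (by positivity)
  rw [Real.sqrt_le_left (by norm_num)]
  norm_num

/-! ### Anticoncentration of linear forms in independent bits -/

lemma abs_cos_le_exp_neg {y : ℝ} (hy : |y| ≤ 1) : |Real.cos y| ≤ Real.exp (-(y ^ 2 / 4)) := by
  have h := abs_le.1 (Real.cos_bound hy)
  have h4 : |y| ^ 4 ≤ y ^ 2 := by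
    rw [← sq_abs y]
    nlinarith [mul_le_mul hy hy (abs_nonneg y) zero_le_one, sq_nonneg (|y|)]
  have h1 : y ^ 2 ≤ 1 := by rw [← sq_abs]; nlinarith [abs_nonneg y]
  rw [abs_of_nonneg (by nlinarith [h.1])]
  have := Real.add_one_le_exp (-(y ^ 2 / 4))
  nlinarith [h.2, sq_nonneg y]

/-- The characteristic function of a linear form in independent centred bits is a product of
cosines. -/
lemma norm_sum_cexp_linearForm {ι : Type*} [Fintype ι] [DecidableEq ι] (w : ι → ℝ) (a : ℝ) :
    ‖∑ z : ι → Bool, Complex.exp (((∑ i, w i * halfSign (z i) + a : ℝ) : ℂ) * Complex.I)‖ =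
      ∏ i, (2 * |Real.cos (w i / 2)|) := by
  have h : ∀ z : ι → Bool,
      Complex.exp (((∑ i, w i * halfSign (z i) + a : ℝ) : ℂ) * Complex.I) =
      Complex.exp (a * Complex.I) *
        ∏ i, Complex.exp (((w i * halfSign (z i) : ℝ) : ℂ) * Complex.I) := by
    intro z
    rw [← Complex.exp_sum, ← Complex.exp_add]
    congr 1
    push_cast
    rw [← Finset.sum_mul]
    ring
  simp only [h]
  rw [← Finset.mul_sum,
    sum_prod_bool fun i b => Complex.exp (((w i * halfSign b : ℝ) : ℂ) * Complex.I),
    norm_mul, Complex.norm_exp_ofReal_mul_I, one_mul, norm_prod]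
  refine Finset.prod_congr rfl fun i _ => ?_
  have e : Complex.exp (((w i * halfSign true : ℝ) : ℂ) * Complex.I) +
      Complex.exp (((w i * halfSign false : ℝ) : ℂ) * Complex.I) =
      ((2 * Real.cos (w i / 2) : ℝ) : ℂ) := by
    push_cast
    rw [Complex.two_cos]
    congr 2
    · simp [halfSign]; ring_nf
    · simp [halfSign]; ring_nf
  rw [e, Complex.norm_real, Real.norm_eq_abs, abs_mul, abs_two]

/-- A linear form in independent bits all of whose coefficients are small, with large total
variance, is anticoncentrated. The Gaussian weight is written as an average of characters, and the
characteristic function of the form is at most `exp (-8 g ^ 2)` for `|g| ≤ 2`. -/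
lemma sum_exp_neg_sq_le_of_small {ι : Type*} [Fintype ι] [DecidableEq ι] (w : ι → ℝ) (a : ℝ)
    {s : ℝ} (hs : 0 ≤ s) (hsmall : ∀ i, s * |w i| ≤ 1) (hbig : 128 ≤ s ^ 2 * ∑ i, w i ^ 2) :
    ∑ z : ι → Bool, Real.exp (-(s ^ 2 / 2) * (∑ i, w i * halfSign (z i) + a) ^ 2) ≤
      1 / 2 * 2 ^ Fintype.card ι := by
  set X : (ι → Bool) → ℝ := fun z => ∑ i, w i * halfSign (z i) + a with hX
  have hchar : ∀ z, ((Real.exp (-(s ^ 2 / 2) * X z ^ 2) : ℝ) : ℂ) =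
      ∫ g : ℝ, Complex.exp ((s * X z : ℝ) * g * Complex.I) ∂gaussianReal 0 1 := by
    intro z
    rw [← charFun_apply_real, charFun_gaussianReal]
    push_cast
    congr 1
    simp
    ring
  have hint : ∀ z, Integrable (fun g : ℝ => Complex.exp ((s * X z : ℝ) * g * Complex.I))
      (gaussianReal 0 1) := by
    intro z
    refine Integrable.of_bound (C := 1) (Continuous.aestronglyMeasurable (by fun_prop))
      (Filter.Eventually.of_forall fun g => ?_)
    rw [← Complex.ofReal_mul, Complex.norm_exp_ofReal_mul_I]
  have hsum : ((∑ z, Real.exp (-(s ^ 2 / 2) * X z ^ 2) : ℝ) : ℂ) =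
      ∫ g : ℝ, ∑ z, Complex.exp ((s * X z : ℝ) * g * Complex.I) ∂gaussianReal 0 1 := by
    rw [integral_finsetSum _ fun z _ => hint z]
    rw [Complex.ofReal_sum]
    exact Finset.sum_congr rfl fun z _ => hchar z
  have hpt : ∀ g : ℝ, ‖∑ z, Complex.exp ((s * X z : ℝ) * g * Complex.I)‖ ≤
      2 ^ Fintype.card ι * (Real.exp (-8 * g ^ 2) + g ^ 2 / 4) := by
    intro g
    have e : ∀ z, (s * X z : ℝ) * (g : ℂ) * Complex.I =
        ((∑ i, (s * g * w i) * halfSign (z i) + s * g * a : ℝ) : ℂ) * Complex.I := by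
      intro z
      rw [← Complex.ofReal_mul]
      congr 2
      rw [hX]
      simp only [mul_add, add_mul, Finset.mul_sum, Finset.sum_mul]
      congr 1
      · exact Finset.sum_congr rfl fun i _ => by ring
      · ring
    simp only [e]
    rw [norm_sum_cexp_linearForm, Finset.prod_mul_distrib, Finset.prod_const, Finset.card_univ]
    refine mul_le_mul_of_nonneg_left ?_ (by positivity)
    by_cases hg : |g| ≤ 2
    · refine le_trans ?_ (le_add_of_nonneg_right (by positivity))
      have : ∀ i ∈ Finset.univ, |Real.cos (s * g * w i / 2)| ≤
          Real.exp (-((s * g * w i / 2) ^ 2 / 4)) := by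
        intro i _
        apply abs_cos_le_exp_neg
        rw [abs_div, abs_mul, abs_mul, abs_of_nonneg hs, abs_two]
        have := mul_le_mul (hsmall i) hg (abs_nonneg g) zero_le_one
        rw [div_le_one (by norm_num)]
        calc s * |g| * |w i| = s * |w i| * |g| := by ring
          _ ≤ _ := by linarith
      refine (Finset.prod_le_prod (fun i _ => abs_nonneg _) this).trans ?_
      rw [← Real.exp_sum, Real.exp_le_exp]
      have e2 : ∑ i, -((s * g * w i / 2) ^ 2 / 4) = -(s ^ 2 * ∑ i, w i ^ 2) * g ^ 2 / 16 := by
        rw [Finset.mul_sum, ← Finset.sum_neg_distrib, Finset.sum_mul, Finset.sum_div]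
        exact Finset.sum_congr rfl fun i _ => by ring
      rw [e2]
      nlinarith [sq_nonneg g]
    · have h1 : ∏ i, |Real.cos (s * g * w i / 2)| ≤ 1 :=
        Finset.prod_le_one (fun i _ => abs_nonneg _) fun i _ => Real.abs_cos_le_one _
      have h2 : 1 ≤ g ^ 2 / 4 := by
        rw [← sq_abs]
        nlinarith [not_le.1 hg]
      linarith [Real.exp_pos (-8 * g ^ 2)]
  obtain ⟨hi, hv⟩ := integrable_gaussianReal_exp_neg_sq (b := 8) (by norm_num)
  have hi2 : Integrable (fun g : ℝ => g ^ 2) (gaussianReal 0 1) :=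
    (memLp_id_gaussianReal' 2 (by norm_num)).integrable_sq
  have hv2 : ∫ g : ℝ, g ^ 2 ∂gaussianReal 0 1 = 1 := by
    have h := variance_fun_id_gaussianReal (μ := 0) (v := 1)
    rw [variance_of_integral_eq_zero (by fun_prop) (by simp)] at h
    simpa using h
  have hb : ‖((∑ z, Real.exp (-(s ^ 2 / 2) * X z ^ 2) : ℝ) : ℂ)‖ ≤
      ∫ g : ℝ, 2 ^ Fintype.card ι * (Real.exp (-8 * g ^ 2) + g ^ 2 / 4) ∂gaussianReal 0 1 := by
    rw [hsum]
    exact norm_integral_le_of_norm_le ((hi.add (hi2.div_const 4)).const_mul _)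
      (Filter.Eventually.of_forall hpt)
  rw [Complex.norm_real, Real.norm_of_nonneg (Finset.sum_nonneg fun z _ => (Real.exp_pos _).le),
    integral_const_mul, integral_add hi (hi2.div_const 4), hv, integral_div, hv2] at hb
  refine hb.trans ?_
  rw [mul_comm]
  refine mul_le_mul_of_nonneg_right ?_ (by positivity)
  have : √(1 / (1 + 2 * 8)) ≤ (1 / 4 : ℝ) := by
    rw [Real.sqrt_le_left (by norm_num)]
    norm_num
  linarith

/-- If one coefficient is large, the two values of its bit are far apart, and at most one of them
can bring the form near zero. -/
lemma sum_exp_neg_sq_le_of_large {ι : Type*} [Fintype ι] [DecidableEq ι] (w : ι → ℝ) (a : ℝ)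
    {t : ℝ} (ht : 0 ≤ t) (i : ι) :
    ∑ z : ι → Bool, Real.exp (-t * (∑ j, w j * halfSign (z j) + a) ^ 2) ≤
      (1 / 2 + 1 / 2 * Real.exp (-t * (w i ^ 2 / 4))) * 2 ^ Fintype.card ι := by
  set F : (ι → Bool) → ℝ := fun z => Real.exp (-t * (∑ j, w j * halfSign (z j) + a) ^ 2) with hF
  -- flipping the bit `i` is an involution of the cube, so the sum is half the sum over pairs
  have hinv : Function.Involutive fun z : ι → Bool => Function.update z i (!z i) := by
    intro z
    funext j
    by_cases h : j = i
    · subst h; simp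
    · simp [h]
  have hflip : ∑ z, F (Function.update z i (!z i)) = ∑ z, F z :=
    Equiv.sum_comp hinv.toPerm F
  have hpair : ∀ z : ι → Bool, F z + F (Function.update z i (!z i)) ≤
      1 + Real.exp (-t * (w i ^ 2 / 4)) := by
    intro z
    set Y : ℝ := ∑ j, w j * halfSign (z j) + a with hY
    have hdiff : ∑ j, w j * halfSign (Function.update z i (!z i) j) + a =
        Y - 2 * w i * halfSign (z i) := by
      rw [hY, ← Finset.add_sum_erase _ _ (Finset.mem_univ i),
        ← Finset.add_sum_erase _ (fun j => w j * halfSign (z j)) (Finset.mem_univ i)]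
      have e1 : ∑ j ∈ Finset.univ.erase i, w j * halfSign (Function.update z i (!z i) j) =
          ∑ j ∈ Finset.univ.erase i, w j * halfSign (z j) :=
        Finset.sum_congr rfl fun j hj => by
          rw [Function.update_of_ne (Finset.ne_of_mem_erase hj)]
      rw [e1, Function.update_self]
      have e2 : halfSign (!z i) = -halfSign (z i) := by
        cases z i <;> norm_num [halfSign]
      rw [e2]
      ring
    have hFz : F (Function.update z i (!z i)) =
        Real.exp (-t * (Y - 2 * w i * halfSign (z i)) ^ 2) := by
      simp only [hF, hdiff]
    rw [hFz]
    change Real.exp (-t * Y ^ 2) + _ ≤ _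
    have hq := halfSign_sq (z i)
    set b := halfSign (z i)
    have hle : ∀ y : ℝ, Real.exp (-t * y ^ 2) ≤ 1 := fun y => by
      rw [Real.exp_le_one_iff]; nlinarith [sq_nonneg y]
    have hw : (2 * w i * b) ^ 2 = w i ^ 2 := by
      rw [mul_pow, mul_pow, hq]; ring
    by_cases h : w i ^ 2 / 4 ≤ Y ^ 2
    · have : Real.exp (-t * Y ^ 2) ≤ Real.exp (-t * (w i ^ 2 / 4)) := by
        rw [Real.exp_le_exp]; nlinarith
      linarith [hle (Y - 2 * w i * b)]
    · have h3 : w i ^ 2 / 4 ≤ (Y - 2 * w i * b) ^ 2 := by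
        nlinarith [sq_nonneg (4 * Y - 2 * (2 * w i * b) )]
      have : Real.exp (-t * (Y - 2 * w i * b) ^ 2) ≤ Real.exp (-t * (w i ^ 2 / 4)) := by
        rw [Real.exp_le_exp]; nlinarith
      linarith [hle Y]
  have htot : ∑ z, (F z + F (Function.update z i (!z i))) ≤
      ∑ _z : ι → Bool, (1 + Real.exp (-t * (w i ^ 2 / 4))) :=
    Finset.sum_le_sum fun z _ => hpair z
  rw [Finset.sum_add_distrib, hflip, Finset.sum_const, Finset.card_univ, nsmul_eq_mul,
    Fintype.card_fun, Fintype.card_bool] at htot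
  push_cast at htot
  linarith

/-- Anticoncentration with the sharp constant `1/2`: for every linear form in independent bits
whose coefficients have square sum at least `κ`, uniformly in the number of bits. -/
lemma exists_sum_exp_neg_sq_le {κ ε : ℝ} (hκ : 0 < κ) (hε : 0 < ε) :
    ∃ t : ℝ, 0 < t ∧ ∀ (ι : Type) [Fintype ι] [DecidableEq ι] (w : ι → ℝ),
      κ ≤ ∑ i, w i ^ 2 → ∀ a : ℝ,
        ∑ z : ι → Bool, Real.exp (-t * (∑ i, w i * halfSign (z i) + a) ^ 2) ≤
          (1 / 2 + ε) * 2 ^ Fintype.card ι := by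
  set s : ℝ := √(128 / κ) with hs
  have hs2 : s ^ 2 = 128 / κ := Real.sq_sqrt (by positivity)
  have hspos : 0 < s := Real.sqrt_pos.2 (by positivity)
  -- the second term makes the far value in a large coordinate have weight at most `ε`
  refine ⟨s ^ 2 / 2 + 4 * s ^ 2 * (1 / ε), by positivity, ?_⟩
  intro ι _ _ w hw a
  set t := s ^ 2 / 2 + 4 * s ^ 2 * (1 / ε) with ht
  have htpos : 0 < t := by positivity
  by_cases h : ∀ i, s * |w i| ≤ 1
  · have hb : 128 ≤ s ^ 2 * ∑ i, w i ^ 2 := by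
      rw [hs2, div_mul_eq_mul_div, le_div_iff₀ hκ]
      linarith
    refine le_trans (Finset.sum_le_sum fun z _ => ?_)
      ((sum_exp_neg_sq_le_of_small w a hspos.le h hb).trans ?_)
    · rw [Real.exp_le_exp]
      refine mul_le_mul_of_nonneg_right ?_ (sq_nonneg _)
      have : 0 < 4 * s ^ 2 * (1 / ε) := by positivity
      linarith
    · exact mul_le_mul_of_nonneg_right (by linarith) (by positivity)
  · push Not at h
    obtain ⟨i, hi⟩ := h
    refine (sum_exp_neg_sq_le_of_large w a htpos.le i).trans ?_
    refine mul_le_mul_of_nonneg_right ?_ (by positivity)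
    have h1 : 1 ≤ s ^ 2 * w i ^ 2 := by
      have : s ^ 2 * w i ^ 2 = (s * |w i|) ^ 2 := by rw [mul_pow, sq_abs]
      rw [this]
      nlinarith
    have h2 : 1 / ε ≤ t * (w i ^ 2 / 4) := by
      have e : 1 / ε ≤ (4 * s ^ 2 * (1 / ε)) * (w i ^ 2 / 4) := by
        have : (4 * s ^ 2 * (1 / ε)) * (w i ^ 2 / 4) = (1 / ε) * (s ^ 2 * w i ^ 2) := by ring
        rw [this]
        exact le_mul_of_one_le_right (by positivity) h1
      refine e.trans (mul_le_mul_of_nonneg_right ?_ (by positivity))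
      rw [ht]
      have : 0 ≤ s ^ 2 / 2 := by positivity
      linarith
    have h3 : Real.exp (-t * (w i ^ 2 / 4)) ≤ ε := by
      have h4 := Real.add_one_le_exp (t * (w i ^ 2 / 4))
      rw [neg_mul, Real.exp_neg]
      apply inv_le_of_inv_le₀ hε
      rw [one_div] at h2
      linarith
    linarith

/-! ### Central binomial coefficients -/

/-- The central binomial coefficients of odd order have the same density as those of the next even
order, so both parities reduce to `Nat.centralBinom`. -/
lemma choose_half_div_two_pow (l : ℕ) :
    (l.choose (l / 2) : ℝ) / 2 ^ l = (Nat.centralBinom ((l + 1) / 2) : ℝ) / 4 ^ ((l + 1) / 2) := by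
  rcases Nat.even_or_odd' l with ⟨j, rfl | rfl⟩
  · have h1 : 2 * j / 2 = j := by omega
    have h2 : (2 * j + 1) / 2 = j := by omega
    rw [h1, h2, Nat.centralBinom_eq_two_mul_choose, pow_mul]
    norm_num
  · have h1 : (2 * j + 1) / 2 = j := by omega
    have h2 : (2 * j + 1 + 1) / 2 = j + 1 := by omega
    have h3 : Nat.centralBinom (j + 1) = 2 * (2 * j + 1).choose j := by
      rw [Nat.centralBinom_eq_two_mul_choose, show 2 * (j + 1) = 2 * j + 1 + 1 by ring,
        Nat.choose_succ_succ, Nat.choose_symm_half]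
      ring
    rw [h1, h2, h3, show (4 : ℝ) = 2 ^ 2 by norm_num, ← pow_mul,
      show 2 * (j + 1) = 2 * j + 1 + 1 by ring, pow_succ (2 : ℝ) (2 * j + 1)]
    push_cast
    field_simp

lemma monotone_centralBinom_sq :
    Monotone fun j : ℕ => ((Nat.centralBinom j : ℝ) / 4 ^ j) ^ 2 * (2 * j) := by
  refine monotone_nat_of_le_succ fun j => ?_
  have h : ((j : ℝ) + 1) * Nat.centralBinom (j + 1) = 2 * (2 * j + 1) * Nat.centralBinom j := by
    exact_mod_cast Nat.succ_mul_centralBinom_succ j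
  have h' : (Nat.centralBinom (j + 1) : ℝ) / 4 ^ (j + 1) =
      (Nat.centralBinom j : ℝ) / 4 ^ j * ((2 * j + 1) / (2 * (j + 1))) := by
    have : (Nat.centralBinom (j + 1) : ℝ) = 2 * (2 * j + 1) * Nat.centralBinom j / (j + 1) := by
      rw [eq_div_iff (by positivity), ← h]; ring
    rw [this, pow_succ]
    field_simp
    ring
  simp only [h']
  rw [mul_pow, mul_assoc]
  refine mul_le_mul_of_nonneg_left ?_ (by positivity)
  push_cast
  rw [div_pow, div_mul_eq_mul_div, le_div_iff₀ (by positivity)]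
  nlinarith [(Nat.cast_nonneg j : (0 : ℝ) ≤ j)]

/-- Up to the factor `2 ^ (n - l)`, central binomial coefficients decay like an inverse square
root. -/
lemma choose_half_mul_le {l n : ℕ} (hl : 0 < l) (hln : l ≤ n) :
    (l.choose (l / 2) : ℝ) ≤
      √((n + 1) / l) * n.choose (n / 2) / 2 ^ (n - l) := by
  have hm := monotone_centralBinom_sq (show (l + 1) / 2 ≤ (n + 1) / 2 by omega)
  simp only [← choose_half_div_two_pow] at hm
  have h1 : (l : ℝ) ≤ 2 * ((l + 1) / 2 : ℕ) := by
    exact_mod_cast (by omega : l ≤ 2 * ((l + 1) / 2))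
  have h2 : 2 * (((n + 1) / 2 : ℕ) : ℝ) ≤ n + 1 := by
    exact_mod_cast (by omega : 2 * ((n + 1) / 2) ≤ n + 1)
  have hl0 : (0 : ℝ) < l := by exact_mod_cast hl
  have h3 : ((l.choose (l / 2) : ℝ) / 2 ^ l) ^ 2 ≤
      (n + 1) / l * ((n.choose (n / 2) : ℝ) / 2 ^ n) ^ 2 := by
    rw [div_mul_eq_mul_div, le_div_iff₀ hl0]
    calc _ ≤ ((l.choose (l / 2) : ℝ) / 2 ^ l) ^ 2 * (2 * ((l + 1) / 2 : ℕ)) :=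
          mul_le_mul_of_nonneg_left h1 (by positivity)
      _ ≤ _ := hm
      _ ≤ ((n.choose (n / 2) : ℝ) / 2 ^ n) ^ 2 * (n + 1) :=
          mul_le_mul_of_nonneg_left h2 (by positivity)
      _ = _ := mul_comm _ _
  have h4 : (l.choose (l / 2) : ℝ) / 2 ^ l ≤ √((n + 1) / l) * ((n.choose (n / 2) : ℝ) / 2 ^ n) := by
    refine (pow_le_pow_iff_left₀ (by positivity) (by positivity) two_ne_zero).1 ?_
    rwa [mul_pow, Real.sq_sqrt (by positivity)]
  rw [div_le_iff₀ (by positivity)] at h4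
  refine h4.trans_eq ?_
  have : (2 : ℝ) ^ n = 2 ^ (n - l) * 2 ^ l := by rw [← pow_add]; congr 1; omega
  rw [this]
  field_simp

/-! ### Comparison of the slice with independent bits -/

/-- The Boolean words of length `n` with exactly `m` letters `true`. -/
def sliceWords (n m : ℕ) : Finset (Fin n → Bool) :=
  Finset.univ.filter fun q => (Finset.univ.filter fun j => q j = true).card = m

lemma card_sliceWords (n m : ℕ) : (sliceWords n m).card = n.choose m := by
  have h : (Finset.univ.powersetCard m : Finset (Finset (Fin n))).card = n.choose m := by
    rw [Finset.card_powersetCard, Finset.card_univ, Fintype.card_fin]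
  rw [← h]
  refine Finset.card_nbij' (fun q => Finset.univ.filter fun j => q j = true)
    (fun s j => decide (j ∈ s)) ?_ ?_ ?_ ?_
  · intro q hq
    simpa [sliceWords] using hq
  · intro s hs
    simpa [sliceWords] using hs
  · intro q _
    funext j
    simp
  · intro s _
    ext j
    simp

/-- Prescribing the letters on `J` leaves a slice of the cube over the complement of `J`. -/
lemma card_sliceWords_fibre_le (n m : ℕ) (J : Finset (Fin n)) (z : J → Bool) :
    ((sliceWords n m).filter fun q => (fun j : J => q j) = z).card ≤
      (n - J.card).choose ((n - J.card) / 2) := by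
  set s := (Finset.univ.filter fun j : J => z j = true).card with hs
  have hc : (Jᶜ.powersetCard (m - s)).card ≤ (n - J.card).choose ((n - J.card) / 2) := by
    rw [Finset.card_powersetCard, Finset.card_compl, Fintype.card_fin]
    exact Nat.choose_le_middle _ _
  refine le_trans ?_ hc
  refine Finset.card_le_card_of_injOn (fun q => Jᶜ.filter fun j => q j = true) ?_ ?_
  · intro q hq
    simp only [sliceWords, Finset.coe_filter, Finset.mem_filter, Finset.mem_univ, true_and,
      Set.mem_ofPred_eq] at hq
    obtain ⟨hm, hz⟩ := hq
    simp only [Finset.mem_coe, Finset.mem_powersetCard]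
    refine ⟨Finset.filter_subset _ _, ?_⟩
    have hJ : (J.filter fun j => q j = true).card = s := by
      rw [hs, ← hz, ← Finset.card_map (Function.Embedding.subtype fun j => j ∈ J)]
      congr 1
      ext j
      simp [and_comm]
    have hsplit := Finset.card_filter_add_card_filter_not
      (s := Finset.univ.filter fun j => q j = true) (fun j => j ∈ J)
    have e1 : ((Finset.univ.filter fun j => q j = true).filter fun j => j ∈ J) =
        J.filter fun j => q j = true := by
      ext j; simp [and_comm]
    have e2 : ((Finset.univ.filter fun j => q j = true).filter fun j => j ∉ J) =
        Jᶜ.filter fun j => q j = true := by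
      ext j; simp [and_comm]
    rw [e1, e2, hJ, hm] at hsplit
    omega
  · intro q hq q' hq' h
    simp only [sliceWords, Finset.coe_filter, Finset.mem_filter, Finset.mem_univ, true_and,
      Set.mem_ofPred_eq] at hq hq'
    funext j
    by_cases hj : j ∈ J
    · exact congrFun (hq.2.trans hq'.2.symm) ⟨j, hj⟩
    · have := congrArg (fun s => j ∈ s) h
      simp only [Finset.mem_filter, Finset.mem_compl, hj, not_false_eq_true, true_and,
        eq_iff_iff] at this
      exact Bool.eq_iff_iff.2 this

/-- The law of finitely many independent slice rows, restricted to the columns in `J`, has density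
at most `√((n + 1) / (n - |J|))` per row with respect to independent bits. -/
lemma sum_slice_restrict_le {n : ℕ} {ι : Type*} [Fintype ι] [DecidableEq ι] (J : Finset (Fin n))
    (hJ : J.card < n) (G : (ι → J → Bool) → ℝ) (hG : ∀ Z, 0 ≤ G Z) :
    ∑ P ∈ Fintype.piFinset (fun _ : ι => sliceWords n (n / 2)), G (fun i j => P i j) ≤
      (√((n + 1) / (n - J.card : ℕ)) * n.choose (n / 2)) ^ Fintype.card ι *
        ((∑ Z, G Z) / (2 ^ J.card) ^ Fintype.card ι) := by
  set S := Fintype.piFinset (fun _ : ι => sliceWords n (n / 2)) with hS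
  set r : (ι → Fin n → Bool) → (ι → J → Bool) := fun P i j => P i j with hr
  have hfib : ∀ Z, ((S.filter fun P => r P = Z).card : ℝ) ≤
      ((n - J.card).choose ((n - J.card) / 2) : ℝ) ^ Fintype.card ι := by
    intro Z
    have e : (S.filter fun P => r P = Z) = Fintype.piFinset fun i =>
        (sliceWords n (n / 2)).filter fun q => (fun j : J => q j) = Z i := by
      ext P
      simp only [hS, Finset.mem_filter, Fintype.mem_piFinset, hr]
      constructor
      · rintro ⟨h1, h2⟩ i
        exact ⟨h1 i, congrFun h2 i⟩
      · intro h
        exact ⟨fun i => (h i).1, funext fun i => (h i).2⟩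
    rw [e, Fintype.card_piFinset]
    push_cast
    refine (Finset.prod_le_prod (fun i _ => by positivity) fun i _ => ?_).trans_eq
      (Finset.prod_const _)
    exact_mod_cast card_sliceWords_fibre_le n (n / 2) J (Z i)
  rw [← Finset.sum_fiberwise S r]
  have hle : ∀ Z ∈ Finset.univ, ∑ P ∈ S.filter (fun P => r P = Z), G (fun i j => P i j) ≤
      ((n - J.card).choose ((n - J.card) / 2) : ℝ) ^ Fintype.card ι * G Z := by
    intro Z _
    have : ∀ P ∈ S.filter (fun P => r P = Z), G (fun i j => P i j) = G Z := by
      intro P hP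
      exact congrArg G (Finset.mem_filter.1 hP).2
    rw [Finset.sum_congr rfl this, Finset.sum_const, nsmul_eq_mul]
    exact mul_le_mul_of_nonneg_right (hfib Z) (hG Z)
  refine (Finset.sum_le_sum hle).trans ?_
  rw [← Finset.mul_sum, ← mul_div_assoc, mul_div_right_comm, ← div_pow]
  refine mul_le_mul_of_nonneg_right (pow_le_pow_left₀ (by positivity) ?_ _)
    (Finset.sum_nonneg fun Z _ => hG Z)
  have h := choose_half_mul_le (l := n - J.card) (n := n) (by omega) (by omega)
  rwa [show n - (n - J.card) = J.card by omega] at h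

/-- Comparison for a product over the rows. -/
lemma sum_slice_prod_rows_le {n : ℕ} {ι : Type*} [Fintype ι] [DecidableEq ι] (J : Finset (Fin n))
    (hJ : J.card < n) (g : (J → Bool) → ℝ) (hg : ∀ z, 0 ≤ g z) {M : ℝ}
    (hM : ∑ z, g z ≤ M * 2 ^ J.card) :
    ∑ P ∈ Fintype.piFinset (fun _ : ι => sliceWords n (n / 2)), ∏ i, g (fun j => P i j) ≤
      (√((n + 1) / (n - J.card : ℕ)) * n.choose (n / 2)) ^ Fintype.card ι *
        M ^ Fintype.card ι := by
  refine (sum_slice_restrict_le J hJ (fun Z => ∏ i, g (Z i))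
    fun Z => Finset.prod_nonneg fun i _ => hg _).trans ?_
  refine mul_le_mul_of_nonneg_left ?_ (by positivity)
  have h := Finset.sum_prod_piFinset (ι := ι) (Finset.univ : Finset (J → Bool)) (fun _ z => g z)
  rw [Fintype.piFinset_univ] at h
  rw [h, Finset.prod_const, Finset.card_univ, ← div_pow]
  refine pow_le_pow_left₀ (div_nonneg (Finset.sum_nonneg fun z _ => hg z) (by positivity)) ?_ _
  rwa [div_le_iff₀ (by positivity)]

/-- Comparison for a product over the columns in `J`. -/
lemma sum_slice_prod_cols_le {n : ℕ} {ι : Type*} [Fintype ι] [DecidableEq ι] (J : Finset (Fin n))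
    (hJ : J.card < n) (g : Fin n → (ι → Bool) → ℝ) (hg : ∀ j z, 0 ≤ g j z) {M : ℝ}
    (hM : ∀ j, ∑ z, g j z ≤ M * 2 ^ Fintype.card ι) :
    ∑ P ∈ Fintype.piFinset (fun _ : ι => sliceWords n (n / 2)), ∏ j ∈ J, g j (fun i => P i j) ≤
      (√((n + 1) / (n - J.card : ℕ)) * n.choose (n / 2)) ^ Fintype.card ι *
        M ^ J.card := by
  have h0 := sum_slice_restrict_le J hJ (fun Z : ι → J → Bool => ∏ j : J, g j (fun i => Z i j))
    fun Z => Finset.prod_nonneg fun i _ => hg _ _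
  have e : ∀ P : ι → Fin n → Bool, ∏ j : J, g j (fun i => P i j) =
      ∏ j ∈ J, g j (fun i => P i j) := fun P =>
    Finset.prod_coe_sort J fun j => g j (fun i => P i j)
  simp only [e] at h0
  refine h0.trans (mul_le_mul_of_nonneg_left ?_ (by positivity))
  have h := (Finset.prod_univ_sum (fun _ : J => (Finset.univ : Finset (ι → Bool)))
    (fun j z => g j z)).symm
  rw [Fintype.piFinset_univ] at h
  have hswap : ∑ Z : ι → J → Bool, ∏ j : J, g j (fun i => Z i j) =
      ∑ Y : J → ι → Bool, ∏ j : J, g j (Y j) :=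
    (Equiv.piComm fun (_ : ι) (_ : J) => Bool).sum_comp fun Y => ∏ j : J, g j (Y j)
  rw [hswap, h, ← pow_mul, mul_comm J.card, pow_mul]
  have hJc : J.card = (Finset.univ : Finset J).card := by simp
  rw [hJc, ← Finset.prod_const, ← Finset.prod_const, ← Finset.prod_div_distrib]
  refine Finset.prod_le_prod (fun j _ => div_nonneg (Finset.sum_nonneg fun z _ => hg _ z)
    (by positivity)) fun j _ => ?_
  rw [div_le_iff₀ (by positivity)]
  exact hM j

/-! ### Exponential moment bounds for the slice matrices -/

/-- The `n × n` bit matrices all of whose rows have exactly `⌊n / 2⌋` letters `true`. -/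
def sliceMatrices (n : ℕ) : Finset (Fin n → Fin n → Bool) :=
  Fintype.piFinset fun _ : Fin n => sliceWords n (n / 2)

/-- The matrix of centred bits. The `0`-`1` matrix is recovered by adding `1 / 2` to every
entry. -/
noncomputable def centredMatrix {n : ℕ} (P : Fin n → Fin n → Bool) : Matrix (Fin n) (Fin n) ℝ :=
  Matrix.of fun i j => halfSign (P i j)

lemma centredMatrix_mulVec {n : ℕ} (P : Fin n → Fin n → Bool) (w : Fin n → ℝ) (i : Fin n) :
    (centredMatrix P *ᵥ w) i = ∑ j, w j * halfSign (P i j) := by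
  simp [centredMatrix, Matrix.mulVec, dotProduct, mul_comm]

lemma centredMatrix_transpose_mulVec {n : ℕ} (P : Fin n → Fin n → Bool) (w : Fin n → ℝ)
    (j : Fin n) : ((centredMatrix P)ᵀ *ᵥ w) j = ∑ i, w i * halfSign (P i j) := by
  simp [centredMatrix, Matrix.mulVec, dotProduct, mul_comm]

/-- Exponential Markov inequality for the counting measure. -/
lemma card_filter_le_exp {α : Type*} (S : Finset α) (X : α → ℝ) (p : α → Prop) [DecidablePred p]
    (hp : ∀ x ∈ S, p x → 0 ≤ X x) : ((S.filter p).card : ℝ) ≤ ∑ x ∈ S, Real.exp (X x) := by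
  rw [Finset.card_filter]
  push_cast
  refine Finset.sum_le_sum fun x hx => ?_
  split_ifs with h
  · exact Real.one_le_exp (hp x hx h)
  · exact (Real.exp_pos _).le

/-- At most three quarters of the columns: the density of the slice is at most `2` per row. -/
lemma sqrt_density_le_two {n k : ℕ} (hk : k < n) (h : n + 1 ≤ 4 * (n - k)) :
    √(((n : ℝ) + 1) / (n - k : ℕ)) ≤ 2 := by
  have h0 : (0 : ℝ) < (n - k : ℕ) := by exact_mod_cast Nat.sub_pos_of_lt hk
  rw [Real.sqrt_le_left (by norm_num), div_le_iff₀ h0]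
  have : ((n + 1 : ℕ) : ℝ) ≤ (4 * (n - k) : ℕ) := by exact_mod_cast h
  push_cast at this ⊢
  linarith

/-- Upper tail for the image of a column vector, using only the columns in `J`. -/
lemma card_rows_large_le {n : ℕ} (w : Fin n → ℝ) (hw : 0 < ∑ j, w j ^ 2) (J : Finset (Fin n))
    (hJ : J.card < n) (hJ4 : n + 1 ≤ 4 * (n - J.card)) :
    (((sliceMatrices n).filter fun P =>
      9 * n * ∑ j, w j ^ 2 < ∑ i, (∑ j ∈ J, w j * halfSign (P i j)) ^ 2).card : ℝ) ≤
      (n.choose (n / 2) : ℝ) ^ n * (4 * Real.exp (-9)) ^ n := by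
  set W := ∑ j, w j ^ 2 with hW
  have hg := sum_exp_sq_linearForm_le (ι := J) (fun j => w j) (s := W⁻¹) (by positivity) (by
    rw [inv_mul_le_iff₀ hw, mul_one, Finset.sum_coe_sort J fun j => w j ^ 2, hW]
    exact Finset.sum_le_sum_of_subset_of_nonneg (Finset.subset_univ _)
      fun _ _ _ => sq_nonneg _)
  rw [Fintype.card_coe] at hg
  have h1 := sum_slice_prod_rows_le (ι := Fin n) J hJ
    (fun z => Real.exp (W⁻¹ * (∑ j : J, w j * halfSign (z j)) ^ 2))
    (fun z => (Real.exp_pos _).le) hg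
  have h2 := card_filter_le_exp (sliceMatrices n) (fun P => -(9 * n) +
      ∑ i, W⁻¹ * (∑ j ∈ J, w j * halfSign (P i j)) ^ 2)
    (fun P => 9 * n * W < ∑ i, (∑ j ∈ J, w j * halfSign (P i j)) ^ 2) (by
      intro P _ hP
      rw [← Finset.mul_sum, inv_mul_eq_div, ← sub_eq_neg_add, sub_nonneg, le_div_iff₀ hw]
      exact hP.le)
  refine h2.trans ?_
  simp only [Real.exp_add, Real.exp_sum]
  rw [← Finset.mul_sum]
  have e : ∀ P : Fin n → Fin n → Bool, ∏ i, Real.exp (W⁻¹ *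
      (∑ j : J, w j * halfSign (P i j)) ^ 2) =
      ∏ i, Real.exp (W⁻¹ * (∑ j ∈ J, w j * halfSign (P i j)) ^ 2) := by
    intro P
    refine Finset.prod_congr rfl fun i _ => ?_
    rw [Finset.sum_coe_sort J fun j => w j * halfSign (P i j)]
  simp only [e, Fintype.card_fin] at h1
  refine (mul_le_mul_of_nonneg_left h1 (Real.exp_pos _).le).trans ?_
  rw [show -(9 * (n : ℝ)) = n * (-9) by ring, Real.exp_nat_mul, ← mul_pow, ← mul_pow, ← mul_pow]
  refine pow_le_pow_left₀ (by positivity) ?_ _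
  have := sqrt_density_le_two hJ hJ4
  calc Real.exp (-9) * (√(((n : ℝ) + 1) / (n - J.card : ℕ)) * n.choose (n / 2) * 2)
      ≤ Real.exp (-9) * (2 * n.choose (n / 2) * 2) := by gcongr
    _ = _ := by ring

/-- Upper tail for the coordinates in `J` of the image of a row vector. -/
lemma card_cols_large_le {n : ℕ} (w : Fin n → ℝ) (hw : 0 < ∑ j, w j ^ 2) (J : Finset (Fin n))
    (hJ : J.card < n) (hJ4 : n + 1 ≤ 4 * (n - J.card)) :
    (((sliceMatrices n).filter fun P =>
      9 * n * ∑ j, w j ^ 2 < ∑ j ∈ J, (∑ i, w i * halfSign (P i j)) ^ 2).card : ℝ) ≤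
      (n.choose (n / 2) : ℝ) ^ n * (4 * Real.exp (-9)) ^ n := by
  set W := ∑ j, w j ^ 2 with hW
  have hg := sum_exp_sq_linearForm_le w (s := W⁻¹) (by positivity) (by
    rw [inv_mul_le_iff₀ hw, mul_one])
  have h1 := sum_slice_prod_cols_le (ι := Fin n) J hJ
    (fun _ z => Real.exp (W⁻¹ * (∑ i, w i * halfSign (z i)) ^ 2))
    (fun _ z => (Real.exp_pos _).le) (fun _ => hg)
  have h2 := card_filter_le_exp (sliceMatrices n) (fun P => -(9 * n) +
      ∑ j ∈ J, W⁻¹ * (∑ i, w i * halfSign (P i j)) ^ 2)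
    (fun P => 9 * n * W < ∑ j ∈ J, (∑ i, w i * halfSign (P i j)) ^ 2) (by
      intro P _ hP
      rw [← Finset.mul_sum, inv_mul_eq_div, ← sub_eq_neg_add, sub_nonneg, le_div_iff₀ hw]
      exact hP.le)
  refine h2.trans ?_
  simp only [Real.exp_add, Real.exp_sum]
  rw [← Finset.mul_sum]
  refine (mul_le_mul_of_nonneg_left h1 (Real.exp_pos _).le).trans ?_
  rw [Fintype.card_fin]
  have h3 : (2 : ℝ) ^ J.card ≤ 2 ^ n := pow_le_pow_right₀ (by norm_num) hJ.le
  refine (mul_le_mul_of_nonneg_left (mul_le_mul_of_nonneg_left h3 (by positivity))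
    (Real.exp_pos _).le).trans ?_
  rw [show -(9 * (n : ℝ)) = n * (-9) by ring, Real.exp_nat_mul, ← mul_pow, ← mul_pow, ← mul_pow]
  refine pow_le_pow_left₀ (by positivity) ?_ _
  have := sqrt_density_le_two hJ hJ4
  calc Real.exp (-9) * (√(((n : ℝ) + 1) / (n - J.card : ℕ)) * n.choose (n / 2) * 2)
      ≤ Real.exp (-9) * (2 * n.choose (n / 2) * 2) := by gcongr
    _ = _ := by ring

/-- The matrix `L` maps every vector `w` with entries in `{-1, 0, 1}` to a vector of norm at most
`6 √n ‖w‖`. This replaces a bound on the operator norm. -/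
def SignBounded {n : ℕ} (L : Matrix (Fin n) (Fin n) ℝ) : Prop :=
  ∀ w : Fin n → ℝ, (∀ i, w i ∈ ({-1, 0, 1} : Finset ℝ)) →
    ∑ i, (L *ᵥ w) i ^ 2 ≤ 36 * n * ∑ i, w i ^ 2

open Classical in
/-- All but an exponentially small proportion of the slice matrices are sign bounded, together with
their transposes. The columns are split into two halves, on each of which the slice is comparable
to independent bits. -/
lemma card_not_signBounded_le {n : ℕ} (hn : 3 ≤ n) :
    (((sliceMatrices n).filter fun P =>
      ¬ (SignBounded (centredMatrix P) ∧ SignBounded (centredMatrix P)ᵀ)).card : ℝ) ≤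
      (n.choose (n / 2) : ℝ) ^ n * (4 * (12 * Real.exp (-9)) ^ n) := by
  set C := (n.choose (n / 2) : ℝ) ^ n with hC
  obtain ⟨J, -, hJc⟩ := Finset.exists_subset_card_eq (s := (Finset.univ : Finset (Fin n)))
    (n := n / 2) (by rw [Finset.card_univ, Fintype.card_fin]; omega)
  have hJcc : Jᶜ.card = n - n / 2 := by rw [Finset.card_compl, Fintype.card_fin, hJc]
  set B : (Fin n → ℝ) → Finset (Fin n) → Finset (Fin n → Fin n → Bool) := fun w J =>
    ((sliceMatrices n).filter fun P =>
      9 * n * ∑ j, w j ^ 2 < ∑ i, (∑ j ∈ J, w j * halfSign (P i j)) ^ 2) ∪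
    ((sliceMatrices n).filter fun P =>
      9 * n * ∑ j, w j ^ 2 < ∑ j ∈ J, (∑ i, w i * halfSign (P i j)) ^ 2) with hB
  set V : Finset (Fin n → ℝ) := Fintype.piFinset fun _ => ({-1, 0, 1} : Finset ℝ) with hV
  have hVc : V.card ≤ 3 ^ n := by
    rw [hV, Fintype.card_piFinset, Finset.prod_const, Finset.card_univ, Fintype.card_fin]
    exact Nat.pow_le_pow_left Finset.card_le_three _
  have hsub : ((sliceMatrices n).filter fun P =>
      ¬ (SignBounded (centredMatrix P) ∧ SignBounded (centredMatrix P)ᵀ)) ⊆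
      (V.filter fun w => 0 < ∑ j, w j ^ 2).biUnion fun w => B w J ∪ B w Jᶜ := by
    intro P hP
    obtain ⟨hPS, hP⟩ := Finset.mem_filter.1 hP
    by_contra hcon
    apply hP
    have key : ∀ w ∈ V, 0 < ∑ j, w j ^ 2 → P ∉ B w J ∧ P ∉ B w Jᶜ := by
      intro w hw h0
      constructor <;> intro h <;> apply hcon <;> rw [Finset.mem_biUnion] <;>
        refine ⟨w, Finset.mem_filter.2 ⟨hw, h0⟩, Finset.mem_union.2 ?_⟩
      · exact Or.inl h
      · exact Or.inr h
    have hzero : ∀ w : Fin n → ℝ, ¬ 0 < ∑ j, w j ^ 2 → w = 0 := by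
      intro w hw
      have h0 : ∑ j, w j ^ 2 = 0 :=
        le_antisymm (not_lt.1 hw) (Finset.sum_nonneg fun _ _ => sq_nonneg _)
      rw [Finset.sum_eq_zero_iff_of_nonneg fun _ _ => sq_nonneg _] at h0
      funext j
      simpa using h0 j (Finset.mem_univ j)
    constructor
    · intro w hw
      by_cases h0 : 0 < ∑ j, w j ^ 2
      · obtain ⟨h1, h2⟩ := key w (by simpa [hV] using hw) h0
        simp only [hB, Finset.mem_union, Finset.mem_filter, hPS, true_and, not_or, not_lt] at h1 h2
        have : ∑ i, (centredMatrix P *ᵥ w) i ^ 2 ≤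
            ∑ i, (2 * (∑ j ∈ J, w j * halfSign (P i j)) ^ 2 +
              2 * (∑ j ∈ Jᶜ, w j * halfSign (P i j)) ^ 2) := by
          refine Finset.sum_le_sum fun i _ => ?_
          rw [centredMatrix_mulVec, ← Finset.sum_add_sum_compl J]
          nlinarith [sq_nonneg (∑ j ∈ J, w j * halfSign (P i j) -
            ∑ j ∈ Jᶜ, w j * halfSign (P i j))]
        rw [Finset.sum_add_distrib, ← Finset.mul_sum, ← Finset.mul_sum] at this
        linarith [h1.1, h2.1]
      · simp [hzero w h0]
    · intro w hw
      by_cases h0 : 0 < ∑ j, w j ^ 2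
      · obtain ⟨h1, h2⟩ := key w (by simpa [hV] using hw) h0
        simp only [hB, Finset.mem_union, Finset.mem_filter, hPS, true_and, not_or, not_lt] at h1 h2
        have : ∑ j, ((centredMatrix P)ᵀ *ᵥ w) j ^ 2 =
            ∑ j ∈ J, (∑ i, w i * halfSign (P i j)) ^ 2 +
              ∑ j ∈ Jᶜ, (∑ i, w i * halfSign (P i j)) ^ 2 := by
          rw [Finset.sum_add_sum_compl]
          exact Finset.sum_congr rfl fun j _ => by rw [centredMatrix_transpose_mulVec]
        rw [this]
        have : 0 ≤ (n : ℝ) * ∑ j, w j ^ 2 := by positivity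
        linarith [h1.2, h2.2]
      · simp [hzero w h0]
  have hBc : ∀ w, 0 < ∑ j, w j ^ 2 → ∀ J : Finset (Fin n), J.card < n →
      n + 1 ≤ 4 * (n - J.card) → ((B w J).card : ℝ) ≤ 2 * (C * (4 * Real.exp (-9)) ^ n) := by
    intro w h0 J h1 h2
    refine (Nat.cast_le.2 (Finset.card_union_le _ _)).trans ?_
    push_cast
    linarith [card_rows_large_le w h0 J h1 h2, card_cols_large_le w h0 J h1 h2]
  calc (((sliceMatrices n).filter fun P =>
      ¬ (SignBounded (centredMatrix P) ∧ SignBounded (centredMatrix P)ᵀ)).card : ℝ)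
      ≤ (((V.filter fun w => 0 < ∑ j, w j ^ 2).biUnion fun w => B w J ∪ B w Jᶜ).card : ℝ) :=
        Nat.cast_le.2 (Finset.card_le_card hsub)
    _ ≤ ∑ w ∈ V.filter (fun w => 0 < ∑ j, w j ^ 2), ((B w J ∪ B w Jᶜ).card : ℝ) := by
        exact_mod_cast Finset.card_biUnion_le
    _ ≤ ∑ w ∈ V.filter (fun w => 0 < ∑ j, w j ^ 2), 4 * (C * (4 * Real.exp (-9)) ^ n) := by
        refine Finset.sum_le_sum fun w hw => ?_
        have h0 := (Finset.mem_filter.1 hw).2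
        refine (Nat.cast_le.2 (Finset.card_union_le _ _)).trans ?_
        push_cast
        have h1 := hBc w h0 J (by omega) (by omega)
        have h2 := hBc w h0 Jᶜ (by omega) (by omega)
        linarith
    _ ≤ 3 ^ n * (4 * (C * (4 * Real.exp (-9)) ^ n)) := by
        rw [Finset.sum_const, nsmul_eq_mul]
        refine mul_le_mul_of_nonneg_right ?_ (by positivity)
        exact_mod_cast (Finset.card_filter_le _ _).trans hVc
    _ = _ := by
        rw [show (12 : ℝ) * Real.exp (-9) = 3 * (4 * Real.exp (-9)) by ring, mul_pow 3]
        ring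

/-! ### Small ball bounds for a fixed vector -/

/-- The anticoncentration property with Gaussian weight `exp (-t y ^ 2)` and constant `q` for
linear forms in independent bits whose coefficients have square sum at least `κ`. -/
def AntiConcentrated (κ t q : ℝ) : Prop :=
  ∀ (ι : Type) [Fintype ι] [DecidableEq ι] (w : ι → ℝ), κ ≤ ∑ i, w i ^ 2 → ∀ a : ℝ,
    ∑ z : ι → Bool, Real.exp (-t * (∑ i, w i * halfSign (z i) + a) ^ 2) ≤
      q * 2 ^ Fintype.card ι

/-- Small ball bound for a column vector supported on few coordinates. -/
lemma card_mulVec_small_le {n : ℕ} {κ t q : ℝ} (ht : 0 ≤ t) (hq : AntiConcentrated κ t q)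
    (w : Fin n → ℝ) (J : Finset (Fin n)) (hJ : J.card < n) (hw : κ ≤ ∑ j ∈ J, w j ^ 2)
    (hwJ : ∀ j ∉ J, w j = 0) (a T : ℝ) :
    (((sliceMatrices n).filter fun P =>
      ∑ i, ((centredMatrix P *ᵥ w) i + a) ^ 2 ≤ T).card : ℝ) ≤
      (n.choose (n / 2) : ℝ) ^ n * (Real.exp (t * T) *
        (√((n + 1) / (n - J.card : ℕ)) ^ n * q ^ n)) := by
  have hg := hq J (fun j => w j) (by rwa [Finset.sum_coe_sort J fun j => w j ^ 2]) a
  rw [Fintype.card_coe] at hg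
  have h1 := sum_slice_prod_rows_le (ι := Fin n) J hJ
    (fun z => Real.exp (-t * (∑ j : J, w j * halfSign (z j) + a) ^ 2))
    (fun z => (Real.exp_pos _).le) hg
  have h2 := card_filter_le_exp (sliceMatrices n) (fun P => t * T +
      ∑ i, -t * ((centredMatrix P *ᵥ w) i + a) ^ 2)
    (fun P => ∑ i, ((centredMatrix P *ᵥ w) i + a) ^ 2 ≤ T) (by
      intro P _ hP
      rw [← Finset.mul_sum]
      nlinarith)
  refine h2.trans ?_
  simp only [Real.exp_add, Real.exp_sum]
  rw [← Finset.mul_sum]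
  have e : ∀ P : Fin n → Fin n → Bool, ∏ i, Real.exp (-t *
      (∑ j : J, w j * halfSign (P i j) + a) ^ 2) =
      ∏ i, Real.exp (-t * ((centredMatrix P *ᵥ w) i + a) ^ 2) := by
    intro P
    refine Finset.prod_congr rfl fun i _ => ?_
    rw [Finset.sum_coe_sort J fun j => w j * halfSign (P i j), centredMatrix_mulVec,
      Finset.sum_subset (Finset.subset_univ J)]
    intro j _ hj
    rw [hwJ j hj, zero_mul]
  simp only [e, Fintype.card_fin] at h1
  refine (mul_le_mul_of_nonneg_left h1 (Real.exp_pos _).le).trans_eq ?_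
  rw [mul_pow]
  ring

/-- Small ball bound for a row vector with enough mass on a small set `I` of rows. The rows outside
`I` are frozen, so that the loss in density is paid only for the rows in `I`; in exchange only the
columns in `J` are used. -/
lemma card_vecMul_small_le {n : ℕ} {κ t q : ℝ} (ht : 0 ≤ t) (hq : AntiConcentrated κ t q)
    (w : Fin n → ℝ) (I J : Finset (Fin n)) (hJ : J.card < n) (hw : κ ≤ ∑ i ∈ I, w i ^ 2)
    (a T : ℝ) :
    (((sliceMatrices n).filter fun P =>
      ∑ j, (((centredMatrix P)ᵀ *ᵥ w) j + a) ^ 2 ≤ T).card : ℝ) ≤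
      (n.choose (n / 2) : ℝ) ^ n * (Real.exp (t * T) *
        (√((n + 1) / (n - J.card : ℕ)) ^ I.card * q ^ J.card)) := by
  have h2 := card_filter_le_exp (sliceMatrices n) (fun P => t * T +
      ∑ j ∈ J, -t * (((centredMatrix P)ᵀ *ᵥ w) j + a) ^ 2)
    (fun P => ∑ j, (((centredMatrix P)ᵀ *ᵥ w) j + a) ^ 2 ≤ T) (by
      intro P _ hP
      rw [← Finset.mul_sum]
      have : ∑ j ∈ J, (((centredMatrix P)ᵀ *ᵥ w) j + a) ^ 2 ≤ T :=
        (Finset.sum_le_sum_of_subset_of_nonneg (Finset.subset_univ _)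
          fun _ _ _ => sq_nonneg _).trans hP
      nlinarith)
  refine h2.trans ?_
  simp only [Real.exp_add, Real.exp_sum]
  rw [← Finset.mul_sum]
  set G : ({i // i ∈ I} → Fin n → Bool) × ({i // i ∉ I} → Fin n → Bool) → ℝ := fun x =>
    ∏ j ∈ J, Real.exp (-t * (∑ i : {i // i ∈ I}, w i * halfSign (x.1 i j) +
      (∑ i : {i // i ∉ I}, w i * halfSign (x.2 i j) + a)) ^ 2) with hG
  set A := Fintype.piFinset fun _ : {i // i ∈ I} => sliceWords n (n / 2)
  set B := Fintype.piFinset fun _ : {i // i ∉ I} => sliceWords n (n / 2) with hB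
  have hsum : ∑ P ∈ sliceMatrices n, ∏ j ∈ J, Real.exp (-t *
      (((centredMatrix P)ᵀ *ᵥ w) j + a) ^ 2) = ∑ x ∈ A ×ˢ B, G x := by
    refine Finset.sum_equiv (Equiv.piEquivPiSubtypeProd (fun i => i ∈ I)
      (fun _ => Fin n → Bool)) ?_ ?_
    · intro P
      simp only [sliceMatrices, Fintype.mem_piFinset, Finset.mem_product, A, B]
      constructor
      · intro h
        exact ⟨fun i => h i, fun i => h i⟩
      · rintro ⟨h1, h2⟩ i
        by_cases hi : i ∈ I
        · exact h1 ⟨i, hi⟩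
        · exact h2 ⟨i, hi⟩
    · intro P _
      refine Finset.prod_congr rfl fun j _ => ?_
      have hsplit : ∑ i, w i * halfSign (P i j) =
          ∑ i : {i // i ∈ I}, w i * halfSign (P i j) +
            ∑ i : {i // i ∉ I}, w i * halfSign (P i j) := by
        rw [← Fintype.sum_subtype_add_sum_subtype (fun i => i ∈ I)]
        congr!
      rw [centredMatrix_transpose_mulVec, hsplit, add_assoc]
      rfl
  rw [hsum, Finset.sum_product_right]
  have hin : ∀ R ∈ B, ∑ Q ∈ A, G (Q, R) ≤
      (√((n + 1) / (n - J.card : ℕ)) * n.choose (n / 2)) ^ I.card * q ^ J.card := by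
    intro R _
    have h := sum_slice_prod_cols_le (ι := {i // i ∈ I}) J hJ
      (fun j z => Real.exp (-t * (∑ i : {i // i ∈ I}, w i * halfSign (z i) +
        (∑ i : {i // i ∉ I}, w i * halfSign (R i j) + a)) ^ 2))
      (fun j z => (Real.exp_pos _).le)
      (fun j => hq {i // i ∈ I} (fun i => w i)
        (by rwa [Finset.sum_coe_sort I fun j => w j ^ 2]) _)
    rwa [Fintype.card_coe] at h
  refine (mul_le_mul_of_nonneg_left (Finset.sum_le_sum hin) (Real.exp_pos _).le).trans_eq ?_
  have hBc : B.card = n.choose (n / 2) ^ (n - I.card) := by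
    rw [hB, Fintype.card_piFinset, Finset.prod_const, card_sliceWords, Finset.card_univ,
      Fintype.card_subtype_compl, Fintype.card_fin, Fintype.card_coe]
  have hI : I.card ≤ n := by simpa using Finset.card_le_univ I
  rw [Finset.sum_const, nsmul_eq_mul, hBc, mul_pow]
  push_cast
  have : (n.choose (n / 2) : ℝ) ^ n =
      n.choose (n / 2) ^ (n - I.card) * n.choose (n / 2) ^ I.card := by
    rw [← pow_add, Nat.sub_add_cancel hI]
  rw [this]
  ring

/-! ### Counting integer vectors -/

lemma sum_Icc_pow_natAbs_le {r : ℝ} (hr : 0 ≤ r) (hr2 : r ≤ 1 / 2) (K : ℕ) :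
    ∑ k ∈ Finset.Icc (-(K : ℤ)) K, r ^ k.natAbs ≤ 1 + 4 * r := by
  have hgeom : ∀ m : ℕ, ∑ k ∈ Finset.Icc (-(m : ℤ)) m, r ^ k.natAbs ≤ 1 + 4 * r * (1 - r ^ m) := by
    intro m
    induction m with
    | zero => simp
    | succ m ih =>
      have e : Finset.Icc (-((m + 1 : ℕ) : ℤ)) ((m + 1 : ℕ) : ℤ) =
          insert (-((m : ℤ) + 1)) (insert ((m : ℤ) + 1) (Finset.Icc (-(m : ℤ)) m)) := by
        ext k
        simp only [Finset.mem_Icc, Finset.mem_insert]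
        push_cast
        omega
      rw [e, Finset.sum_insert (by simp only [Finset.mem_insert, Finset.mem_Icc]; omega),
        Finset.sum_insert (by simp only [Finset.mem_Icc]; omega)]
      have h1 : (-((m : ℤ) + 1)).natAbs = m + 1 := by omega
      have h2 : ((m : ℤ) + 1).natAbs = m + 1 := by omega
      rw [h1, h2, pow_succ]
      have : 0 ≤ r ^ m := by positivity
      nlinarith [mul_nonneg this hr]
  refine (hgeom K).trans ?_
  have : 0 ≤ r * r ^ K := by positivity
  nlinarith

/-- The integer vectors of length `n` with `ℓ¹` norm at most `K`. -/
noncomputable def integerBall (n K : ℕ) : Finset (Fin n → ℤ) :=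
  (Fintype.piFinset fun _ : Fin n => Finset.Icc (-(K : ℤ)) K).filter fun z =>
    ∑ i, (z i).natAbs ≤ K

lemma mem_integerBall {n K : ℕ} {z : Fin n → ℤ} :
    z ∈ integerBall n K ↔ ∑ i, (z i).natAbs ≤ K := by
  simp only [integerBall, Finset.mem_filter, Fintype.mem_piFinset, Finset.mem_Icc,
    and_iff_right_iff_imp]
  intro h i
  have := (Finset.single_le_sum (f := fun i => (z i).natAbs) (fun _ _ => Nat.zero_le _)
    (Finset.mem_univ i)).trans h
  omega

lemma card_integerBall_le {r : ℝ} (hr : 0 < r) (hr2 : r ≤ 1 / 2) (n K : ℕ) :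
    ((integerBall n K).card : ℝ) ≤ (1 / r) ^ K * (1 + 4 * r) ^ n := by
  rw [one_div, inv_pow, inv_mul_eq_div, le_div_iff₀ (by positivity)]
  calc ((integerBall n K).card : ℝ) * r ^ K = ∑ _z ∈ integerBall n K, r ^ K := by
        rw [Finset.sum_const, nsmul_eq_mul]
    _ ≤ ∑ z ∈ integerBall n K, ∏ i, r ^ (z i).natAbs := by
        refine Finset.sum_le_sum fun z hz => ?_
        rw [Finset.prod_pow_eq_pow_sum]
        exact pow_le_pow_of_le_one hr.le (by linarith) (mem_integerBall.1 hz)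
    _ ≤ ∑ z ∈ Fintype.piFinset fun _ : Fin n => Finset.Icc (-(K : ℤ)) K,
          ∏ i, r ^ (z i).natAbs :=
        Finset.sum_le_sum_of_subset_of_nonneg (Finset.filter_subset _ _)
          fun z _ _ => Finset.prod_nonneg fun i _ => by positivity
    _ = (∑ k ∈ Finset.Icc (-(K : ℤ)) K, r ^ k.natAbs) ^ n := by
        rw [Finset.sum_prod_piFinset _ fun (_ : Fin n) (k : ℤ) => r ^ k.natAbs,
          Finset.prod_const, Finset.card_univ, Fintype.card_fin]
    _ ≤ _ := pow_le_pow_left₀ (Finset.sum_nonneg fun _ _ => by positivity)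
        (sum_Icc_pow_natAbs_le hr.le hr2 K) n

/-! ### Reduction of almost constant vectors to a net -/

/-- The Euclidean norm of a plain vector. -/
noncomputable def euclNorm {n : ℕ} (v : Fin n → ℝ) : ℝ :=
  ‖(WithLp.toLp 2 v : EuclideanSpace ℝ (Fin n))‖

lemma euclNorm_nonneg {n : ℕ} (v : Fin n → ℝ) : 0 ≤ euclNorm v := norm_nonneg _

lemma euclNorm_sq {n : ℕ} (v : Fin n → ℝ) : euclNorm v ^ 2 = ∑ i, v i ^ 2 := by
  rw [euclNorm, EuclideanSpace.norm_sq_eq]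
  simp

lemma euclNorm_add_le {n : ℕ} (v w : Fin n → ℝ) :
    euclNorm (v + w) ≤ euclNorm v + euclNorm w := by
  rw [euclNorm, WithLp.toLp_add]
  exact norm_add_le _ _

lemma euclNorm_smul {n : ℕ} (c : ℝ) (v : Fin n → ℝ) :
    euclNorm (c • v) = |c| * euclNorm v := by
  rw [euclNorm, WithLp.toLp_smul, norm_smul, Real.norm_eq_abs, euclNorm]

lemma euclNorm_neg {n : ℕ} (v : Fin n → ℝ) : euclNorm (-v) = euclNorm v := by
  rw [← neg_one_smul ℝ v, euclNorm_smul]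
  simp

lemma euclNorm_le_iff {n : ℕ} (v : Fin n → ℝ) {b : ℝ} (hb : 0 ≤ b) :
    euclNorm v ≤ b ↔ ∑ i, v i ^ 2 ≤ b ^ 2 := by
  rw [← euclNorm_sq, pow_le_pow_iff_left₀ (euclNorm_nonneg v) hb two_ne_zero]

lemma euclNorm_one {n : ℕ} : euclNorm (1 : Fin n → ℝ) = √(n : ℝ) := by
  rw [eq_comm, Real.sqrt_eq_iff_mul_self_eq (by positivity) (euclNorm_nonneg _), ← sq,
    euclNorm_sq]
  simp

lemma abs_sum_le_sqrt_mul {n : ℕ} (v : Fin n → ℝ) : |∑ i, v i| ≤ √(n : ℝ) * euclNorm v := by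
  refine abs_le_of_sq_le_sq ?_ (mul_nonneg (Real.sqrt_nonneg _) (euclNorm_nonneg _))
  rw [mul_pow, Real.sq_sqrt (by positivity), euclNorm_sq]
  have := sq_sum_le_card_mul_sum_sq (s := Finset.univ) (f := v)
  simpa using this

/-- The trivial bound through the Frobenius norm. -/
lemma euclNorm_mulVec_le {n : ℕ} {L : Matrix (Fin n) (Fin n) ℝ} (hL : ∀ i j, |L i j| ≤ 1 / 2)
    (w : Fin n → ℝ) : euclNorm (L *ᵥ w) ≤ n / 2 * euclNorm w := by
  rw [euclNorm_le_iff _ (mul_nonneg (by positivity) (euclNorm_nonneg _)), mul_pow, euclNorm_sq]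
  have : ∀ i ∈ Finset.univ, (L *ᵥ w) i ^ 2 ≤ n / 4 * ∑ j, w j ^ 2 := by
    intro i _
    refine (Finset.sum_mul_sq_le_sq_mul_sq Finset.univ (fun j => L i j) w).trans ?_
    refine mul_le_mul_of_nonneg_right ?_ (Finset.sum_nonneg fun _ _ => sq_nonneg _)
    calc ∑ j, L i j ^ 2 ≤ ∑ _j : Fin n, (1 / 4 : ℝ) := by
          refine Finset.sum_le_sum fun j _ => ?_
          rw [← sq_abs]
          nlinarith [hL i j, abs_nonneg (L i j)]
      _ = n / 4 := by simp; ring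
  refine (Finset.sum_le_sum this).trans_eq ?_
  simp
  ring

/-- A sign bounded matrix is bounded on every cube `[-r, r]^S`, because a convex function attains
its maximum over the cube at a vertex. -/
lemma SignBounded.euclNorm_mulVec_le {n : ℕ} {L : Matrix (Fin n) (Fin n) ℝ} (hL : SignBounded L)
    (S : Finset (Fin n)) {r : ℝ} (hr : 0 ≤ r) (v : Fin n → ℝ) (hv : ∀ i, |v i| ≤ r)
    (hvS : ∀ i ∉ S, v i = 0) :
    euclNorm (L *ᵥ v) ≤ 6 * √(n : ℝ) * (r * √(S.card : ℝ)) := by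
  set T : (Fin n → ℝ) →ₗ[ℝ] EuclideanSpace ℝ (Fin n) :=
    (WithLp.linearEquiv 2 ℝ (Fin n → ℝ)).symm.toLinearMap ∘ₗ L.mulVecLin with hT
  have hconv : ConvexOn ℝ Set.univ fun v : Fin n → ℝ => euclNorm (L *ᵥ v) :=
    convexOn_univ_norm.comp_linearMap T
  have hmem : v ∈ convexHull ℝ
      (Set.pi Set.univ fun i => if i ∈ S then ({-r, r} : Set ℝ) else {0}) := by
    rw [convexHull_pi]
    intro i _
    by_cases hi : i ∈ S
    · simp only [hi, if_true]
      rw [convexHull_pair, segment_eq_Icc (by linarith)]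
      exact abs_le.1 (hv i)
    · simp [hi, hvS i hi]
  obtain ⟨y, hy, hle⟩ := hconv.exists_ge_of_mem_convexHull (Set.subset_univ _) hmem
  refine hle.trans ?_
  set w : Fin n → ℝ := fun i => if i ∈ S then (if y i = r then 1 else -1) else 0 with hw
  have hyw : y = r • w := by
    funext i
    have h := hy i (Set.mem_univ i)
    by_cases hi : i ∈ S
    · simp only [hi, if_true, Set.mem_insert_iff, Set.mem_singleton_iff] at h
      by_cases h2 : y i = r
      · simp [hw, hi, h2]
      · simp only [Pi.smul_apply, hw, hi, h2, if_true, if_false, smul_eq_mul, mul_neg, mul_one]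
        exact h.resolve_right h2
    · simp only [hi, if_false, Set.mem_singleton_iff] at h
      simp [hw, hi, h]
  have hwsq : ∑ i, w i ^ 2 = S.card := by
    have : ∀ i, w i ^ 2 = if i ∈ S then 1 else 0 := by
      intro i
      simp only [hw]
      split_ifs <;> norm_num
    simp [this]
  have hw1 : euclNorm (L *ᵥ w) ≤ 6 * √(n : ℝ) * √(S.card : ℝ) := by
    rw [euclNorm_le_iff _ (mul_nonneg (by positivity) (Real.sqrt_nonneg _)), mul_pow, mul_pow,
      Real.sq_sqrt (Nat.cast_nonneg n), Real.sq_sqrt (Nat.cast_nonneg S.card), ← hwsq]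
    refine (hL w fun i => ?_).trans_eq (by ring)
    simp only [hw]
    split_ifs <;> simp
  rw [hyw, Matrix.mulVec_smul, euclNorm_smul, abs_of_nonneg hr]
  calc r * euclNorm (L *ᵥ w) ≤ r * (6 * √(n : ℝ) * √(S.card : ℝ)) :=
        mul_le_mul_of_nonneg_left hw1 hr
    _ = _ := by ring

/-- Rounding down to a multiple of `h`. -/
lemma abs_sub_mul_floor_le {h : ℝ} (hh : 0 < h) (x : ℝ) : |x - h * ⌊x / h⌋| ≤ h := by
  have h1 := Int.floor_le (x / h)
  have h2 := Int.lt_floor_add_one (x / h)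
  rw [le_div_iff₀ hh] at h1
  rw [div_lt_iff₀ hh] at h2
  rw [abs_le]
  constructor <;> nlinarith

lemma abs_floor_div_le {h : ℝ} (hh : 0 < h) {x b : ℝ} (hx : |x| ≤ b) :
    |(⌊x / h⌋ : ℝ)| ≤ b / h + 1 := by
  have h0 : |x / h| ≤ b / h := by
    rw [abs_div, abs_of_pos hh]
    exact div_le_div_of_nonneg_right hx hh.le
  have h1 := Int.floor_le (x / h)
  have h2 := Int.lt_floor_add_one (x / h)
  rw [abs_le] at *
  constructor <;> linarith [h0.1, h0.2]

/-- Splitting an almost constant vector into a constant `a`, a part `u` supported on a set `S` of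
at most `δ n` coordinates, and a part `v` with coordinates at most `ρ / √n`. -/
lemma exists_decomposition_of_almostConstant {n : ℕ} (hn : 0 < n) {δ ρ : ℝ}
    (hδ : δ ≤ 1 / 9) (hρ0 : 0 ≤ ρ) (hρ : ρ ≤ 1 / 16) {x : EuclideanSpace ℝ (Fin n)}
    (hx : x ∈ almostConstant n δ ρ) :
    ∃ (a : ℝ) (S : Finset (Fin n)) (u v : Fin n → ℝ),
      x.ofLp = a • 1 + u + v ∧ (S.card : ℝ) ≤ δ * n ∧ |a| * √(n : ℝ) ≤ 3 ∧
      (∀ i ∉ S, u i = 0) ∧ (∀ i, |v i| ≤ ρ / √(n : ℝ)) ∧ ∑ i, u i ^ 2 ≤ 4 := by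
  classical
  obtain ⟨hx1, a, ha⟩ := hx
  have hn0 : (0 : ℝ) < n := by exact_mod_cast hn
  have hsn : 0 < √(n : ℝ) := Real.sqrt_pos.2 hn0
  set G : Finset (Fin n) := Finset.univ.filter fun i => |x i - a| ≤ ρ / √(n : ℝ) with hG
  have hGc : (({i : Fin n | |x i - a| ≤ ρ / √(n : ℝ)} : Set (Fin n)).ncard : ℝ) = G.card := by
    rw [← Set.ncard_coe_finset]
    congr 2
    ext i
    simp [hG]
  rw [hGc] at ha
  have hxsq : ∑ i, x i ^ 2 = 1 := by
    have := euclNorm_sq x.ofLp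
    rw [← this]
    change ‖x‖ ^ 2 = 1
    rw [hx1, one_pow]
  have hGn : (G.card : ℝ) ≤ n := by
    exact_mod_cast (Finset.card_le_univ G).trans_eq (Fintype.card_fin n)
  have hcard : (Gᶜ.card : ℝ) = n - G.card := by
    rw [Finset.card_compl, Fintype.card_fin, Nat.cast_sub (by exact_mod_cast hGn)]
  have ha2 : a ^ 2 * n ≤ 9 := by
    have h1 : ∑ i ∈ G, a ^ 2 ≤ ∑ i ∈ G, (2 * x i ^ 2 + 2 * (ρ ^ 2 / n)) := by
      refine Finset.sum_le_sum fun i hi => ?_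
      have hi2 : (x i - a) ^ 2 ≤ ρ ^ 2 / n := by
        rw [← sq_abs, ← Real.sq_sqrt hn0.le, ← div_pow]
        exact pow_le_pow_left₀ (abs_nonneg _) (Finset.mem_filter.1 hi).2 2
      nlinarith [sq_nonneg (2 * x i - a)]
    rw [Finset.sum_add_distrib, ← Finset.mul_sum, Finset.sum_const, Finset.sum_const, nsmul_eq_mul,
      nsmul_eq_mul] at h1
    have h2 : ∑ i ∈ G, x i ^ 2 ≤ 1 := hxsq ▸
      Finset.sum_le_sum_of_subset_of_nonneg (Finset.subset_univ _) fun _ _ _ => sq_nonneg _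
    have h3 : (G.card : ℝ) * (2 * (ρ ^ 2 / n)) ≤ 2 * ρ ^ 2 := by
      calc (G.card : ℝ) * (2 * (ρ ^ 2 / n)) ≤ n * (2 * (ρ ^ 2 / n)) :=
            mul_le_mul_of_nonneg_right hGn (by positivity)
        _ = _ := by field_simp
    have h4 : (8 / 9 * n) * a ^ 2 ≤ G.card * a ^ 2 :=
      mul_le_mul_of_nonneg_right (by nlinarith) (sq_nonneg a)
    nlinarith
  refine ⟨a, Gᶜ, fun i => if i ∈ G then 0 else x i - a, fun i => if i ∈ G then x i - a else 0,
    ?_, ?_, ?_, ?_, ?_, ?_⟩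
  · funext i
    by_cases hi : i ∈ G <;> simp [hi]
  · rw [hcard]
    linarith
  · refine abs_le_of_sq_le_sq' ?_ (by norm_num) |>.2
    rw [mul_pow, sq_abs, Real.sq_sqrt hn0.le]
    linarith
  · intro i hi
    simp only [Finset.mem_compl, not_not] at hi
    simp [hi]
  · intro i
    by_cases hi : i ∈ G
    · simp only [hi, if_true]
      exact (Finset.mem_filter.1 hi).2
    · simp only [hi, if_false, abs_zero]
      positivity
  · have h1 : ∑ i, (if i ∈ G then 0 else x i - a) ^ 2 ≤
        ∑ i, (2 * x i ^ 2 + (if i ∈ Gᶜ then 2 * a ^ 2 else 0)) := by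
      refine Finset.sum_le_sum fun i _ => ?_
      by_cases hi : i ∈ G
      · simp only [hi, if_true, Finset.mem_compl, not_true, if_false]
        nlinarith [sq_nonneg (x i)]
      · simp only [hi, if_false, Finset.mem_compl, not_false_eq_true, if_true]
        nlinarith [sq_nonneg (x i + a)]
    rw [Finset.sum_add_distrib, ← Finset.mul_sum, hxsq, Finset.sum_ite_mem, Finset.univ_inter,
      Finset.sum_const, nsmul_eq_mul, hcard] at h1
    have h2 : (n - G.card) * (2 * a ^ 2) ≤ (1 / 9 * n) * (2 * a ^ 2) :=
      mul_le_mul_of_nonneg_right (by nlinarith) (by positivity)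
    nlinarith

/-- If `L` nearly cancels the mean part of an almost constant vector, the sparse part of this vector
is not small: otherwise the vector is close to a multiple of the all-ones vector, whose mean part
has norm of order `n`, whereas `L` contributes `O(√n)` on the constant and little on the rest. -/
lemma sum_sq_sparse_ge {n : ℕ} (hn : 10000 ≤ n) {ρ c : ℝ} (hρ : ρ ≤ 1 / 16) (hc : c ≤ 1)
    {L : Matrix (Fin n) (Fin n) ℝ} (hLe : ∀ i j, |L i j| ≤ 1 / 2) (hL : SignBounded L)
    {x u v : Fin n → ℝ} {a : ℝ} (hx : x = a • 1 + u + v) (hx1 : euclNorm x = 1)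
    (ha : |a| * √(n : ℝ) ≤ 3) (hv : ∀ i, |v i| ≤ ρ / √(n : ℝ))
    (hsmall : euclNorm (L *ᵥ x + (1 / 2 * ∑ i, x i) • 1) ≤ c * √(n : ℝ)) :
    1 / 256 ≤ ∑ i, u i ^ 2 := by
  by_contra hu
  have hn0 : (0 : ℝ) < n := by exact_mod_cast (by omega : 0 < n)
  set s : ℝ := √(n : ℝ) with hs
  have hss : s * s = n := Real.mul_self_sqrt hn0.le
  have hs100 : 100 ≤ s := by
    rw [hs, Real.le_sqrt (by norm_num) hn0.le]
    norm_num
    exact_mod_cast hn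
  have hu' : euclNorm u ≤ 1 / 16 := by
    rw [euclNorm_le_iff _ (by norm_num)]
    linarith [not_le.1 hu]
  have hv' : euclNorm v ≤ 1 / 16 := by
    rw [euclNorm_le_iff _ (by norm_num)]
    calc ∑ i, v i ^ 2 ≤ ∑ _i : Fin n, (1 / 16 / s) ^ 2 := by
          refine Finset.sum_le_sum fun i _ => ?_
          rw [← sq_abs]
          exact pow_le_pow_left₀ (abs_nonneg _) ((hv i).trans (by gcongr)) 2
      _ = (1 / 16) ^ 2 := by
          rw [Finset.sum_const, Finset.card_univ, Fintype.card_fin, nsmul_eq_mul, div_pow, sq s,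
            hss]
          field_simp
  have haone : euclNorm (a • (1 : Fin n → ℝ)) = |a| * s := by rw [euclNorm_smul, euclNorm_one]
  have ha' : 7 / 8 ≤ |a| * s := by
    have h1 := euclNorm_add_le (a • 1 + u) v
    have h2 := euclNorm_add_le (a • 1) u
    rw [← hx, hx1] at h1
    linarith
  have hsum : ∑ i, x i = a * n + ∑ i, u i + ∑ i, v i := by
    rw [hx]
    simp [Finset.sum_add_distrib, mul_comm]
  have hsum' : 3 / 4 * s ≤ |∑ i, x i| := by
    have h1 := (abs_sum_le_sqrt_mul u).trans (mul_le_mul_of_nonneg_left hu' (by positivity))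
    have h2 := (abs_sum_le_sqrt_mul v).trans (mul_le_mul_of_nonneg_left hv' (by positivity))
    have h3 : |a * n| ≤ |∑ i, x i| + |∑ i, u i| + |∑ i, v i| := by
      have : a * n = ∑ i, x i + (-∑ i, u i) + (-∑ i, v i) := by rw [hsum]; ring
      rw [this]
      refine (abs_add_three _ _ _).trans_eq ?_
      rw [abs_neg, abs_neg]
    rw [abs_mul, abs_of_pos hn0, ← hss] at h3
    nlinarith
  have hmean : 3 / 8 * n ≤ euclNorm ((1 / 2 * ∑ i, x i) • (1 : Fin n → ℝ)) := by
    rw [euclNorm_smul, euclNorm_one, abs_mul, abs_of_pos (by norm_num : (0 : ℝ) < 1 / 2), ← hs,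
      ← hss]
    nlinarith
  have hLx : euclNorm (L *ᵥ x) ≤ 18 * s + n / 16 := by
    have h1 : euclNorm (L *ᵥ (1 : Fin n → ℝ)) ≤ 6 * n := by
      have := hL.euclNorm_mulVec_le Finset.univ zero_le_one 1 (by simp) (by simp)
      rwa [Finset.card_univ, Fintype.card_fin, one_mul, mul_assoc, ← hs, hss] at this
    have h2 := (euclNorm_mulVec_le hLe u).trans (mul_le_mul_of_nonneg_left hu' (by positivity))
    have h3 := (euclNorm_mulVec_le hLe v).trans (mul_le_mul_of_nonneg_left hv' (by positivity))
    have h4 : L *ᵥ x = a • L *ᵥ 1 + L *ᵥ u + L *ᵥ v := by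
      rw [hx, Matrix.mulVec_add, Matrix.mulVec_add, Matrix.mulVec_smul]
    have h5 := euclNorm_add_le (a • L *ᵥ 1 + L *ᵥ u) (L *ᵥ v)
    have h6 := euclNorm_add_le (a • L *ᵥ 1) (L *ᵥ u)
    rw [euclNorm_smul] at h6
    have h7 : |a| * euclNorm (L *ᵥ (1 : Fin n → ℝ)) ≤ 18 * s := by
      refine (mul_le_mul_of_nonneg_left h1 (abs_nonneg a)).trans ?_
      rw [← hss]
      nlinarith
    rw [h4]
    linarith
  have hfin : euclNorm ((1 / 2 * ∑ i, x i) • (1 : Fin n → ℝ)) ≤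
      euclNorm (L *ᵥ x + (1 / 2 * ∑ i, x i) • 1) + euclNorm (L *ᵥ x) := by
    have := euclNorm_add_le (L *ᵥ x + (1 / 2 * ∑ i, x i) • 1) (-(L *ᵥ x))
    rwa [euclNorm_neg, add_neg_cancel_comm] at this
  have : c * s ≤ 1 * s := mul_le_mul_of_nonneg_right hc (by positivity)
  nlinarith

/-- The discretized vector with constant part `η k / √n` and sparse part `(η / √(δ n)) z`. -/
noncomputable def netVector (n : ℕ) (δ η : ℝ) (k : ℤ) (z : Fin n → ℤ) : Fin n → ℝ :=
  (η / √(n : ℝ) * k) • 1 + fun i => η / √(δ * n) * z i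

/-- If a sign bounded matrix `L` nearly cancels the mean part of some almost constant vector, it
nearly does so for a discretized vector whose integer part `z` has small `ℓ¹` norm. -/
lemma exists_netVector {n : ℕ} (hn : 10000 ≤ n) {δ ρ η c : ℝ} (hδ0 : 0 < δ) (hδ : δ ≤ 1 / 9)
    (hρ0 : 0 ≤ ρ) (hρ : ρ ≤ 1 / 16) (hη0 : 0 < η) (hη : η ≤ 1 / 32) (hc : c ≤ 1)
    {L : Matrix (Fin n) (Fin n) ℝ} (hLe : ∀ i j, |L i j| ≤ 1 / 2) (hL : SignBounded L)
    {x : EuclideanSpace ℝ (Fin n)} (hx : x ∈ almostConstant n δ ρ)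
    (hsmall : euclNorm (L *ᵥ x.ofLp + (1 / 2 * ∑ i, x i) • 1) ≤ c * √(n : ℝ)) :
    ∃ (k l : ℤ) (z : Fin n → ℤ), |(k : ℝ)| ≤ 3 / η + 1 ∧ |(l : ℝ)| ≤ √(n : ℝ) / η + 1 ∧
      ((∑ i, (z i).natAbs : ℕ) : ℝ) ≤ 10 * δ / η ^ 2 * n ∧
      1 / 1024 ≤ ∑ i, (η / √(δ * n) * z i) ^ 2 ∧
      euclNorm (L *ᵥ netVector n δ η k z + (η * l) • 1) ≤
        (c + 13 * η + 6 * ρ) * √(n : ℝ) := by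
  obtain ⟨a, S, u, v, hdec, hS, ha, huS, hv, hu⟩ :=
    exists_decomposition_of_almostConstant (by omega) hδ hρ0 hρ hx
  have hx1 : euclNorm x.ofLp = 1 := hx.1
  have hlow := sum_sq_sparse_ge hn hρ hc hLe hL hdec hx1 ha hv hsmall
  have hn0 : (0 : ℝ) < n := by exact_mod_cast (by omega : 0 < n)
  set s : ℝ := √(n : ℝ) with hs
  have hs0 : 0 < s := Real.sqrt_pos.2 hn0
  have hss : s * s = n := Real.mul_self_sqrt hn0.le
  set h : ℝ := η / √(δ * n) with hh
  have hδn : 0 < δ * n := by positivity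
  have hh0 : 0 < h := div_pos hη0 (Real.sqrt_pos.2 hδn)
  have hh2 : h ^ 2 = η ^ 2 / (δ * n) := by rw [hh, div_pow, Real.sq_sqrt hδn.le]
  set A : ℝ := 1 / 2 * ∑ i, x i with hA
  have hA1 : |A| ≤ s := by
    have h1 := abs_sum_le_sqrt_mul x.ofLp
    rw [hx1, mul_one] at h1
    rw [hA, abs_mul, abs_of_pos (by norm_num : (0 : ℝ) < 1 / 2)]
    linarith [h1, abs_nonneg (∑ i, x i)]
  set z : Fin n → ℤ := fun i => ⌊u i / h⌋ with hz
  set d : Fin n → ℝ := fun i => u i - h * z i with hd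
  have hd1 : ∀ i, |d i| ≤ h := fun i => abs_sub_mul_floor_le hh0 (u i)
  have hd0 : ∀ i ∉ S, d i = 0 := fun i hi => by simp [hd, hz, huS i hi]
  have hhS : h * √(S.card : ℝ) ≤ η := by
    rw [hh, div_mul_eq_mul_div, div_le_iff₀ (Real.sqrt_pos.2 hδn)]
    exact mul_le_mul_of_nonneg_left (Real.sqrt_le_sqrt hS) hη0.le
  have hdsq : ∑ i, d i ^ 2 ≤ η ^ 2 := by
    calc ∑ i, d i ^ 2 = ∑ i ∈ S, d i ^ 2 := by
          refine (Finset.sum_subset (Finset.subset_univ S) fun i _ hi => ?_).symm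
          rw [hd0 i hi]; norm_num
      _ ≤ ∑ _i ∈ S, h ^ 2 := Finset.sum_le_sum fun i _ => by
          rw [← sq_abs]; exact pow_le_pow_left₀ (abs_nonneg _) (hd1 i) 2
      _ = (h * √(S.card : ℝ)) ^ 2 := by
          rw [Finset.sum_const, nsmul_eq_mul, mul_pow, Real.sq_sqrt (by positivity), mul_comm]
      _ ≤ η ^ 2 := pow_le_pow_left₀ (by positivity) hhS 2
  have hη2 : η ^ 2 ≤ 1 / 1024 := by nlinarith
  set b : ℝ := η / s * ⌊a * s / η⌋ with hb
  have hab : |a - b| ≤ η / s := by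
    have h1 := abs_sub_mul_floor_le (div_pos hη0 hs0) a
    rwa [div_div_eq_mul_div] at h1
  refine ⟨⌊a * s / η⌋, ⌊A / η⌋, z, ?_, abs_floor_div_le hη0 hA1, ?_, ?_, ?_⟩
  · refine abs_floor_div_le hη0 ?_
    rwa [abs_mul, abs_of_pos hs0]
  · have h1 : ∑ i, (h * z i) ^ 2 ≤ 10 := by
      have : ∑ i, (h * z i) ^ 2 ≤ ∑ i, (2 * u i ^ 2 + 2 * d i ^ 2) := by
        refine Finset.sum_le_sum fun i _ => ?_
        have : h * z i = u i - d i := by simp [hd]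
        rw [this]
        nlinarith [sq_nonneg (u i + d i)]
      rw [Finset.sum_add_distrib, ← Finset.mul_sum, ← Finset.mul_sum] at this
      linarith
    have h2 : ((∑ i, (z i).natAbs : ℕ) : ℝ) ≤ ∑ i, (z i : ℝ) ^ 2 := by
      push_cast
      refine Finset.sum_le_sum fun i _ => ?_
      have : (z i).natAbs ≤ (z i).natAbs ^ 2 := Nat.le_self_pow two_ne_zero _
      have h3 : (((z i).natAbs ^ 2 : ℕ) : ℤ) = z i ^ 2 := by
        push_cast; exact sq_abs _
      have h4 : ((z i).natAbs : ℤ) ≤ z i ^ 2 := by rw [← h3]; exact_mod_cast this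
      have h5 : (((z i).natAbs : ℤ) : ℝ) ≤ ((z i ^ 2 : ℤ) : ℝ) := Int.cast_le.2 h4
      push_cast at h5
      rw [Nat.cast_natAbs, Int.cast_abs]
      exact h5
    refine h2.trans ?_
    simp only [mul_pow] at h1
    rw [← Finset.mul_sum, hh2, div_mul_eq_mul_div, div_le_iff₀ hδn] at h1
    rw [div_mul_eq_mul_div, le_div_iff₀ (by positivity)]
    linarith
  · have : ∑ i, u i ^ 2 ≤ ∑ i, (2 * (h * z i) ^ 2 + 2 * d i ^ 2) := by
      refine Finset.sum_le_sum fun i _ => ?_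
      have : u i = h * z i + d i := by simp [hd]
      rw [this]
      nlinarith [sq_nonneg (h * z i - d i)]
    rw [Finset.sum_add_distrib, ← Finset.mul_sum, ← Finset.mul_sum] at this
    linarith
  · have hxv : netVector n δ η ⌊a * s / η⌋ z = x.ofLp - ((a - b) • 1 + d + v) := by
      rw [hdec]
      funext i
      simp only [netVector, Pi.add_apply, Pi.sub_apply, Pi.smul_apply, Pi.one_apply, smul_eq_mul,
        hd, hb, hh, hs]
      ring
    have e : L *ᵥ netVector n δ η ⌊a * s / η⌋ z + (η * ⌊A / η⌋) • 1 =
        (L *ᵥ x.ofLp + A • 1) + (-((a - b) • L *ᵥ 1) + (-(L *ᵥ d) +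
          (-(L *ᵥ v) + -((A - η * ⌊A / η⌋) • 1)))) := by
      rw [hxv, Matrix.mulVec_sub, Matrix.mulVec_add, Matrix.mulVec_add, Matrix.mulVec_smul,
        sub_smul A]
      abel
    rw [e]
    have h1 : euclNorm (-((a - b) • L *ᵥ (1 : Fin n → ℝ))) ≤ 6 * η * s := by
      rw [euclNorm_neg, euclNorm_smul]
      have := hL.euclNorm_mulVec_le Finset.univ zero_le_one 1 (by simp) (by simp)
      rw [Finset.card_univ, Fintype.card_fin, one_mul, ← hs] at this
      calc |a - b| * euclNorm (L *ᵥ (1 : Fin n → ℝ)) ≤ η / s * (6 * s * s) :=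
            mul_le_mul hab this (euclNorm_nonneg _) (by positivity)
        _ = _ := by field_simp
    have h2 : euclNorm (-(L *ᵥ d)) ≤ 6 * η * s := by
      rw [euclNorm_neg]
      refine (hL.euclNorm_mulVec_le S hh0.le d hd1 hd0).trans ?_
      calc 6 * s * (h * √(S.card : ℝ)) ≤ 6 * s * η :=
            mul_le_mul_of_nonneg_left hhS (by positivity)
        _ = _ := by ring
    have h3 : euclNorm (-(L *ᵥ v)) ≤ 6 * ρ * s := by
      rw [euclNorm_neg]
      refine (hL.euclNorm_mulVec_le Finset.univ (by positivity) v hv (by simp)).trans_eq ?_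
      rw [Finset.card_univ, Fintype.card_fin, ← hs]
      field_simp
    have h4 : euclNorm (-((A - η * ⌊A / η⌋) • (1 : Fin n → ℝ))) ≤ η * s := by
      rw [euclNorm_neg, euclNorm_smul, euclNorm_one]
      exact mul_le_mul_of_nonneg_right (abs_sub_mul_floor_le hη0 A) hs0.le
    have t1 := euclNorm_add_le (L *ᵥ x.ofLp + A • 1) (-((a - b) • L *ᵥ 1) + (-(L *ᵥ d) +
          (-(L *ᵥ v) + -((A - η * ⌊A / η⌋) • 1))))
    have t2 := euclNorm_add_le (-((a - b) • L *ᵥ 1)) (-(L *ᵥ d) +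
          (-(L *ᵥ v) + -((A - η * ⌊A / η⌋) • 1)))
    have t3 := euclNorm_add_le (-(L *ᵥ d)) (-(L *ᵥ v) + -((A - η * ⌊A / η⌋) • 1))
    have t4 := euclNorm_add_le (-(L *ᵥ v)) (-((A - η * ⌊A / η⌋) • 1))
    linarith

/-! ### Probability of failure at a point of the net -/

lemma sum_halfSign_of_mem_sliceWords {n m : ℕ} {q : Fin n → Bool} (hq : q ∈ sliceWords n m) :
    ∑ j, halfSign (q j) = m - n / 2 := by
  have h : ∀ j, halfSign (q j) = (if q j = true then 1 else 0) - 1 / 2 := by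
    intro j
    cases q j <;> norm_num [halfSign]
  have hm : (Finset.univ.filter fun j => q j = true).card = m := (Finset.mem_filter.1 hq).2
  simp only [h]
  rw [Finset.sum_sub_distrib, Finset.sum_boole, hm]
  simp
  ring

/-- Integer vectors of `ℓ¹` norm at most `K` have at most `K` nonzero coordinates. -/
lemma card_support_le_of_mem_integerBall {n K : ℕ} {z : Fin n → ℤ} (hz : z ∈ integerBall n K) :
    (Finset.univ.filter fun i => z i ≠ 0).card ≤ K := by
  refine le_trans ?_ (mem_integerBall.1 hz)
  rw [Finset.card_filter]
  refine Finset.sum_le_sum fun i _ => ?_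
  split_ifs with h
  · exact Int.natAbs_pos.2 h
  · exact Nat.zero_le _

/-- Small ball bound at a net point, for columns. On the slice, the row sums of the centred matrix
are deterministic, so the constant part of the net vector only shifts the centre of the ball. -/
lemma card_mulVec_netVector_small_le {n K : ℕ} {t q δ η γ c σ : ℝ} (hn : 0 < n)
    (ht : 0 ≤ t) (hq0 : 0 ≤ q) (hq : AntiConcentrated (1 / 4096) t q) (hγ : γ ≤ 1 / 2)
    (hK : (K : ℝ) ≤ γ * n) (hσ : t * c ^ 2 + γ ≤ σ) (k l : ℤ) {z : Fin n → ℤ}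
    (hz : z ∈ integerBall n K) (hbig : 1 / 1024 ≤ ∑ i, (η / √(δ * n) * z i) ^ 2) :
    (((sliceMatrices n).filter fun P =>
      euclNorm (centredMatrix P *ᵥ netVector n δ η k z + (η * l) • 1) ≤ c * √(n : ℝ)).card : ℝ) ≤
      (n.choose (n / 2) : ℝ) ^ n * (2 * Real.exp (σ * n) * q ^ n) := by
  have hn0 : (0 : ℝ) < n := by exact_mod_cast hn
  set J : Finset (Fin n) := Finset.univ.filter fun i => z i ≠ 0 with hJ
  have hJK : J.card ≤ K := card_support_le_of_mem_integerBall hz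
  have hJγ : (J.card : ℝ) ≤ γ * n := (Nat.cast_le.2 hJK).trans hK
  have hJn : J.card < n := by
    have : (J.card : ℝ) < n := by nlinarith
    exact_mod_cast this
  set w : Fin n → ℝ := fun i => η / √(δ * n) * z i with hw
  have hwJ : ∀ j ∉ J, w j = 0 := by
    intro j hj
    have : z j = 0 := by simpa [hJ] using hj
    simp [hw, this]
  have hwsq : 1 / 4096 ≤ ∑ j ∈ J, w j ^ 2 := by
    rw [Finset.sum_subset (Finset.subset_univ J) fun j _ hj => by rw [hwJ j hj]; norm_num]
    linarith
  have h := card_mulVec_small_le ht hq w J hJn hwsq hwJ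
    (η / √(n : ℝ) * k * ((n / 2 : ℕ) - n / 2) + η * l) (c ^ 2 * n)
  refine le_trans ?_ (h.trans (mul_le_mul_of_nonneg_left ?_ (by positivity)))
  · refine Nat.cast_le.2 (Finset.card_le_card fun P hP => ?_)
    obtain ⟨hPS, hP⟩ := Finset.mem_filter.1 hP
    refine Finset.mem_filter.2 ⟨hPS, ?_⟩
    have hP2 := pow_le_pow_left₀ (euclNorm_nonneg _) hP 2
    rw [euclNorm_sq, mul_pow, Real.sq_sqrt hn0.le] at hP2
    refine le_trans (le_of_eq ?_) hP2
    refine Finset.sum_congr rfl fun i _ => ?_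
    congr 1
    have h1 : (centredMatrix P *ᵥ (1 : Fin n → ℝ)) i = (n / 2 : ℕ) - n / 2 := by
      rw [centredMatrix_mulVec]
      simp only [Pi.one_apply, one_mul]
      exact sum_halfSign_of_mem_sliceWords (Fintype.mem_piFinset.1 hPS i)
    simp only [netVector, Matrix.mulVec_add, Matrix.mulVec_smul, Pi.add_apply, Pi.smul_apply, h1,
      smul_eq_mul, Pi.one_apply, mul_one]
    ring
  · -- `((n + 1) / (n - |J|)) ^ (n / 2) ≤ exp (1 / 2 + γ n)`
    have hden : (1 - γ) * n ≤ (n - J.card : ℕ) := by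
      rw [Nat.cast_sub hJn.le]
      linarith
    have hγ0 : 0 ≤ γ := by
      by_contra hneg
      have : (0 : ℝ) ≤ J.card := Nat.cast_nonneg _
      nlinarith [not_le.1 hneg]
    have hb : √(((n : ℝ) + 1) / (n - J.card : ℕ)) ≤ Real.exp (1 / (2 * n) + γ) := by
      rw [Real.sqrt_le_left (Real.exp_pos _).le, ← Real.exp_nat_mul,
        div_le_iff₀ (lt_of_lt_of_le (by nlinarith) hden)]
      have e1 : 1 + 1 / (n : ℝ) ≤ Real.exp (1 / n) := by
        linarith [Real.add_one_le_exp (1 / (n : ℝ))]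
      have e2 : 1 ≤ Real.exp (2 * γ) * (1 - γ) := by
        have := Real.add_one_le_exp (2 * γ)
        nlinarith
      have e3 : Real.exp ((2 : ℕ) * (1 / (2 * n) + γ)) = Real.exp (1 / n) * Real.exp (2 * γ) := by
        rw [← Real.exp_add]
        congr 1
        push_cast
        field_simp
      rw [e3]
      calc (n : ℝ) + 1 = (1 + 1 / (n : ℝ)) * 1 * n := by field_simp
        _ ≤ Real.exp (1 / n) * (Real.exp (2 * γ) * (1 - γ)) * n := by gcongr
        _ = Real.exp (1 / n) * Real.exp (2 * γ) * ((1 - γ) * n) := by ring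
        _ ≤ _ := by gcongr
    have hbn : √(((n : ℝ) + 1) / (n - J.card : ℕ)) ^ n ≤ 2 * Real.exp (γ * n) := by
      refine (pow_le_pow_left₀ (Real.sqrt_nonneg _) hb n).trans ?_
      rw [← Real.exp_nat_mul]
      have e : (n : ℝ) * (1 / (2 * n) + γ) = 1 / 2 + γ * n := by field_simp
      rw [e, Real.exp_add]
      refine mul_le_mul_of_nonneg_right ?_ (Real.exp_pos _).le
      have h4 : Real.exp (1 / 2) * Real.exp (1 / 2) = Real.exp 1 := by
        rw [← Real.exp_add]; norm_num
      nlinarith [Real.exp_one_lt_d9, Real.exp_pos (1 / 2)]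
    calc Real.exp (t * (c ^ 2 * n)) * (√(((n : ℝ) + 1) / (n - J.card : ℕ)) ^ n * q ^ n)
        ≤ Real.exp (t * (c ^ 2 * n)) * ((2 * Real.exp (γ * n)) * q ^ n) := by gcongr
      _ = 2 * Real.exp ((t * c ^ 2 + γ) * n) * q ^ n := by
          rw [show (t * c ^ 2 + γ) * n = t * (c ^ 2 * n) + γ * n by ring, Real.exp_add]
          ring
      _ ≤ _ := by gcongr

/-- Loss from using only `n - m` columns, where `m` is about `β n`, and from the change of density
in `i ≤ γ n` rows. -/
lemma sqrt_pow_mul_pow_le {n m i : ℕ} {q β γ : ℝ} (hm0 : 0 < m) (hmn : m ≤ n) (hq0 : 1 / 2 ≤ q)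
    (hβ0 : 0 < β) (hβ1 : β ≤ 1) (hIγ : (i : ℝ) ≤ γ * n) (hmβ : β * n ≤ m)
    (hmβ' : (m : ℝ) ≤ β * n + 1) :
    √(((n : ℝ) + 1) / m) ^ i * q ^ (n - m) ≤ 2 * Real.exp ((2 * γ / β + β) * n) * q ^ n := by
  have hqpos : 0 ≤ q := by linarith
  have h1n : (1 : ℝ) ≤ n := by exact_mod_cast hm0.trans_le hmn
  have h2β : 1 ≤ 2 / β := by rw [le_div_iff₀ hβ0]; linarith
  have hs1 : √(((n : ℝ) + 1) / m) ≤ 2 / β := by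
    have hle : ((n : ℝ) + 1) / m ≤ 2 / β := by
      rw [div_le_div_iff₀ (by positivity) hβ0]
      nlinarith
    rw [Real.sqrt_le_left (by positivity)]
    nlinarith
  have hs2 : √(((n : ℝ) + 1) / m) ^ i ≤ Real.exp (2 * γ / β * n) := by
    have h3 : 2 / β ≤ Real.exp (2 / β) := by linarith [Real.add_one_le_exp (2 / β)]
    refine (pow_le_pow_left₀ (Real.sqrt_nonneg _) (hs1.trans h3) _).trans ?_
    rw [← Real.exp_nat_mul, Real.exp_le_exp]
    calc (i : ℝ) * (2 / β) ≤ γ * n * (2 / β) :=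
          mul_le_mul_of_nonneg_right hIγ (by positivity)
      _ = _ := by ring
  have hq2 : q ^ (n - m) ≤ 2 * Real.exp (β * n) * q ^ n := by
    have h4 : q ^ n = q ^ (n - m) * q ^ m := by rw [← pow_add]; congr 1; omega
    have h5 : (1 / 2 : ℝ) ^ m ≤ q ^ m := pow_le_pow_left₀ (by norm_num) hq0 m
    have h6 : (2 : ℝ) ^ m ≤ 2 * Real.exp (β * n) := by
      have h7 : m - 1 + 1 = m := by omega
      have h8 : (2 : ℝ) ^ (m - 1) ≤ Real.exp (β * n) := by
        have : (2 : ℝ) ≤ Real.exp 1 := by linarith [Real.add_one_le_exp (1 : ℝ)]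
        refine (pow_le_pow_left₀ (by norm_num) this _).trans ?_
        rw [← Real.exp_nat_mul, Real.exp_le_exp, Nat.cast_sub hm0]
        push_cast
        linarith
      rw [← h7, pow_succ]
      linarith
    have h9 : (1 : ℝ) ≤ 2 * Real.exp (β * n) * q ^ m := by
      calc (1 : ℝ) = 2 ^ m * (1 / 2) ^ m := by rw [← mul_pow]; norm_num
        _ ≤ _ := mul_le_mul h6 h5 (by positivity) (by positivity)
    rw [h4]
    have h10 : 0 ≤ q ^ (n - m) := pow_nonneg hqpos _
    nlinarith [mul_le_mul_of_nonneg_left h9 h10]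
  have hqn : 0 ≤ q ^ (n - m) := pow_nonneg hqpos _
  calc √(((n : ℝ) + 1) / m) ^ i * q ^ (n - m)
      ≤ Real.exp (2 * γ / β * n) * (2 * Real.exp (β * n) * q ^ n) :=
        mul_le_mul hs2 hq2 hqn (Real.exp_pos _).le
    _ = _ := by
        rw [add_mul, Real.exp_add]
        ring

/-- Small ball bound at a net point, for rows. The constant part of the net vector now has a random
image, but it has little mass on the support of `z`, where the weights remain bounded below. -/
lemma card_vecMul_netVector_small_le {n K : ℕ} {t q δ η γ β c σ : ℝ} (hn : 0 < n)
    (ht : 0 ≤ t) (hq0 : 1 / 2 ≤ q) (hq : AntiConcentrated (1 / 4096) t q)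
    (hη0 : 0 < η) (hη1 : η ≤ 1) (hγ : γ ≤ 1 / 65536) (hβ0 : 0 < β) (hβ1 : β ≤ 1)
    (hK : (K : ℝ) ≤ γ * n) (hσ : t * c ^ 2 + 2 * γ / β + β ≤ σ) {k : ℤ}
    (hk : |(k : ℝ)| ≤ 3 / η + 1) (l : ℤ) {z : Fin n → ℤ}
    (hz : z ∈ integerBall n K) (hbig : 1 / 1024 ≤ ∑ i, (η / √(δ * n) * z i) ^ 2) :
    (((sliceMatrices n).filter fun P =>
      euclNorm ((centredMatrix P)ᵀ *ᵥ netVector n δ η k z + (η * l) • 1) ≤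
        c * √(n : ℝ)).card : ℝ) ≤
      (n.choose (n / 2) : ℝ) ^ n * (2 * Real.exp (σ * n) * q ^ n) := by
  have hn0 : (0 : ℝ) < n := by exact_mod_cast hn
  have hqpos : 0 ≤ q := by linarith
  set I : Finset (Fin n) := Finset.univ.filter fun i => z i ≠ 0 with hI
  have hIγ : (I.card : ℝ) ≤ γ * n :=
    (Nat.cast_le.2 (card_support_le_of_mem_integerBall hz)).trans hK
  set b : ℝ := η / √(n : ℝ) * k with hb
  have hbn : b ^ 2 * n ≤ 16 := by
    have h1 : |η * k| ≤ 4 := by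
      rw [abs_mul, abs_of_pos hη0]
      calc η * |(k : ℝ)| ≤ η * (3 / η + 1) := mul_le_mul_of_nonneg_left hk hη0.le
        _ = 3 + η := by field_simp
        _ ≤ 4 := by linarith
    have h2 : b ^ 2 * n = (η * k) ^ 2 := by
      rw [hb, mul_pow, div_pow, Real.sq_sqrt hn0.le]
      field_simp
    rw [h2, ← sq_abs]
    nlinarith [abs_nonneg (η * k)]
  have hwI : 1 / 4096 ≤ ∑ i ∈ I, netVector n δ η k z i ^ 2 := by
    have h1 : ∑ i ∈ I, (η / √(δ * n) * z i) ^ 2 ≤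
        ∑ i ∈ I, (2 * netVector n δ η k z i ^ 2 + 2 * b ^ 2) := by
      refine Finset.sum_le_sum fun i _ => ?_
      have : netVector n δ η k z i = b + η / √(δ * n) * z i := by
        simp [netVector, hb]
      rw [this]
      nlinarith [sq_nonneg (2 * b + η / √(δ * n) * z i)]
    rw [Finset.sum_subset (Finset.subset_univ I) fun j _ hj => by
      have : z j = 0 := by simpa [hI] using hj
      simp [this], Finset.sum_add_distrib, ← Finset.mul_sum, Finset.sum_const, nsmul_eq_mul] at h1
    have h2 : (I.card : ℝ) * (2 * b ^ 2) ≤ γ * n * (2 * b ^ 2) :=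
      mul_le_mul_of_nonneg_right hIγ (by positivity)
    have hγ0 : 0 ≤ γ := by
      by_contra hneg
      have : (0 : ℝ) ≤ I.card := Nat.cast_nonneg _
      nlinarith [not_le.1 hneg]
    have h3 : γ * (b ^ 2 * n) ≤ 1 / 65536 * 16 := mul_le_mul hγ hbn (by positivity) (by norm_num)
    nlinarith
  -- all columns but a proportion `β`
  set m : ℕ := ⌈β * n⌉₊ with hm
  have hm0 : 0 < m := Nat.ceil_pos.2 (by positivity)
  have hmn : m ≤ n := by
    rw [hm, Nat.ceil_le]
    nlinarith
  have hmβ : β * n ≤ m := Nat.le_ceil _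
  have hmβ' : (m : ℝ) ≤ β * n + 1 := (Nat.ceil_lt_add_one (by positivity)).le
  obtain ⟨J, -, hJc⟩ := Finset.exists_subset_card_eq (s := (Finset.univ : Finset (Fin n)))
    (n := n - m) (by rw [Finset.card_univ, Fintype.card_fin]; omega)
  have h := card_vecMul_small_le ht hq (netVector n δ η k z) I J (by omega) hwI (η * l)
    (c ^ 2 * n)
  refine le_trans ?_ (h.trans (mul_le_mul_of_nonneg_left ?_ (by positivity)))
  · refine Nat.cast_le.2 (Finset.card_le_card fun P hP => ?_)
    obtain ⟨hPS, hP⟩ := Finset.mem_filter.1 hP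
    refine Finset.mem_filter.2 ⟨hPS, ?_⟩
    have hP2 := pow_le_pow_left₀ (euclNorm_nonneg _) hP 2
    rw [euclNorm_sq, mul_pow, Real.sq_sqrt hn0.le] at hP2
    simpa using hP2
  · have hnm : n - J.card = m := by omega
    rw [hnm, hJc]
    have hqn' : 0 ≤ q ^ n := pow_nonneg hqpos _
    calc Real.exp (t * (c ^ 2 * n)) * (√(((n : ℝ) + 1) / m) ^ I.card * q ^ (n - m))
        ≤ Real.exp (t * (c ^ 2 * n)) * (2 * Real.exp ((2 * γ / β + β) * n) * q ^ n) :=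
          mul_le_mul_of_nonneg_left
            (sqrt_pow_mul_pow_le hm0 hmn hq0 hβ0 hβ1 hIγ hmβ hmβ') (Real.exp_pos _).le
      _ = 2 * Real.exp ((t * c ^ 2 + 2 * γ / β + β) * n) * q ^ n := by
          rw [show (t * c ^ 2 + 2 * γ / β + β) * n =
            t * (c ^ 2 * n) + (2 * γ / β + β) * n by ring, Real.exp_add]
          ring
      _ ≤ 2 * Real.exp (σ * n) * q ^ n :=
          mul_le_mul_of_nonneg_right (mul_le_mul_of_nonneg_left (Real.exp_le_exp.2
            (mul_le_mul_of_nonneg_right hσ hn0.le)) zero_le_two) hqn'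

/-! ### The union bound -/

lemma mem_Icc_of_abs_le {B : ℝ} {k : ℤ} (hk : |(k : ℝ)| ≤ B) :
    k ∈ Finset.Icc (-(⌊B⌋₊ : ℤ)) ⌊B⌋₊ := by
  have h1 : k.natAbs ≤ ⌊B⌋₊ := by
    refine Nat.le_floor ?_
    rwa [Nat.cast_natAbs, Int.cast_abs]
  rw [Finset.mem_Icc]
  omega

lemma card_Icc_floor_le {B : ℝ} (hB : 0 ≤ B) :
    ((Finset.Icc (-(⌊B⌋₊ : ℤ)) ⌊B⌋₊).card : ℝ) ≤ 2 * B + 1 := by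
  rw [Int.card_Icc]
  have : ((⌊B⌋₊ : ℤ) + 1 - -(⌊B⌋₊ : ℤ)).toNat = 2 * ⌊B⌋₊ + 1 := by omega
  rw [this]
  push_cast
  linarith [Nat.floor_le hB]

/-- The matrix of centred bits plus its mean nearly annihilates an almost constant vector, from one
of the two sides. -/
def NearlySingular {n : ℕ} (δ ρ c : ℝ) (P : Fin n → Fin n → Bool) : Prop :=
  ∃ x ∈ almostConstant n δ ρ,
    euclNorm (centredMatrix P *ᵥ x.ofLp + (1 / 2 * ∑ i, x i) • 1) ≤ c * √(n : ℝ) ∨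
    euclNorm ((centredMatrix P)ᵀ *ᵥ x.ofLp + (1 / 2 * ∑ i, x i) • 1) ≤ c * √(n : ℝ)

/-- The exceptional probability in `card_not_signBounded_le` is at most half of the target. -/
lemma four_mul_pow_le_half_mul_pow {n : ℕ} (hn : 1 ≤ n) {p : ℝ} (hp : 1 / 2 ≤ p) :
    4 * (12 * Real.exp (-9)) ^ n ≤ 1 / 2 * p ^ n := by
  have he : Real.exp (-9) ≤ 1 / 512 := by
    rw [Real.exp_neg, one_div]
    refine inv_anti₀ (by norm_num) ?_
    have h2 : (2 : ℝ) ≤ Real.exp 1 := by linarith [Real.add_one_le_exp (1 : ℝ)]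
    have h9 : Real.exp 9 = Real.exp 1 ^ 9 := by rw [← Real.exp_nat_mul]; norm_num
    rw [h9]
    calc (512 : ℝ) = 2 ^ 9 := by norm_num
      _ ≤ _ := pow_le_pow_left₀ (by norm_num) h2 9
  have h1 : (12 * Real.exp (-9)) ^ n ≤ (1 / 16) ^ n * p ^ n := by
    rw [← mul_pow]
    refine pow_le_pow_left₀ (by positivity) ?_ n
    linarith
  have h3 : (1 / 16 : ℝ) ^ n ≤ 1 / 16 := pow_le_of_le_one (by norm_num) (by norm_num) (by omega)
  have h4 : 0 ≤ p ^ n := pow_nonneg (by linarith) n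
  nlinarith

open Classical in
/-- The exponential bound for the proportion of nearly singular slice matrices, with explicit
relations between the parameters. -/
lemma card_nearlySingular_le {n : ℕ} {t q σ η β r γ : ℝ} (hn : 10000 ≤ n)
    (ht : 0 ≤ t) (hq0 : 1 / 2 ≤ q) (hq : AntiConcentrated (1 / 4096) t q) (hσ : 0 < σ)
    (hη0 : 0 < η) (hη : η ≤ 1 / 32) (hηt : 400 * t * η ^ 2 ≤ σ / 10)
    (hβ0 : 0 < β) (hβ1 : β ≤ 1) (hβσ : β ≤ σ / 10)
    (hr0 : 0 < r) (hr2 : r ≤ 1 / 2) (hrσ : 4 * r ≤ σ / 10)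
    (hγ0 : 0 < γ) (hγ : γ ≤ 1 / 65536) (hγβ : 2 * γ / β ≤ σ / 10) (hγr : γ / r ≤ σ / 10)
    (hnσ : 64 * (6 / η + 3) * (2 / η + 3) ≤ σ ^ 2 * n) :
    (((sliceMatrices n).filter (NearlySingular (γ * η ^ 2 / 10) η η)).card : ℝ) ≤
      (n.choose (n / 2) : ℝ) ^ n * (q * Real.exp σ) ^ n := by
  set δ : ℝ := γ * η ^ 2 / 10 with hδ
  have hn1 : (1 : ℝ) ≤ n := by exact_mod_cast (by omega : 1 ≤ n)
  set K : ℕ := ⌊γ * n⌋₊ with hK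
  have hKγ : (K : ℝ) ≤ γ * n := Nat.floor_le (by positivity)
  set N : Finset (ℤ × ℤ × (Fin n → ℤ)) :=
    Finset.Icc (-(⌊3 / η + 1⌋₊ : ℤ)) ⌊3 / η + 1⌋₊ ×ˢ
      Finset.Icc (-(⌊√(n : ℝ) / η + 1⌋₊ : ℤ)) ⌊√(n : ℝ) / η + 1⌋₊ ×ˢ integerBall n K with hN
  set N' := N.filter fun y => |(y.1 : ℝ)| ≤ 3 / η + 1 ∧
    1 / 1024 ≤ ∑ i, (η / √(δ * n) * y.2.2 i) ^ 2 with hN'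
  set c : ℝ := 20 * η with hc
  set E : ℤ × ℤ × (Fin n → ℤ) → Finset (Fin n → Fin n → Bool) := fun y =>
    ((sliceMatrices n).filter fun P =>
      euclNorm (centredMatrix P *ᵥ netVector n δ η y.1 y.2.2 + (η * y.2.1) • 1) ≤ c * √(n : ℝ)) ∪
    ((sliceMatrices n).filter fun P =>
      euclNorm ((centredMatrix P)ᵀ *ᵥ netVector n δ η y.1 y.2.2 + (η * y.2.1) • 1) ≤
        c * √(n : ℝ)) with hE
  set D := (sliceMatrices n).filter fun P =>
      ¬ (SignBounded (centredMatrix P) ∧ SignBounded (centredMatrix P)ᵀ) with hD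
  have hsub : (sliceMatrices n).filter (NearlySingular δ η η) ⊆ D ∪ N'.biUnion E := by
    intro P hP
    obtain ⟨hPS, x, hx, hP⟩ := Finset.mem_filter.1 hP
    by_cases hgood : SignBounded (centredMatrix P) ∧ SignBounded (centredMatrix P)ᵀ
    · have hδ0 : 0 < δ := by positivity
      have hδ1 : δ ≤ 1 / 9 := by
        rw [hδ]
        have : γ * η ^ 2 ≤ 1 * 1 :=
          mul_le_mul (by linarith) (by nlinarith) (sq_nonneg _) (by norm_num)
        linarith
      have hent : ∀ i j, |centredMatrix P i j| ≤ 1 / 2 := fun i j => (abs_halfSign _).le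
      have hγδ : 10 * δ / η ^ 2 = γ := by rw [hδ]; field_simp
      have hmemN : ∀ (k l : ℤ) (z : Fin n → ℤ), |(k : ℝ)| ≤ 3 / η + 1 →
          |(l : ℝ)| ≤ √(n : ℝ) / η + 1 →
          ((∑ i, (z i).natAbs : ℕ) : ℝ) ≤ 10 * δ / η ^ 2 * n →
          1 / 1024 ≤ ∑ i, (η / √(δ * n) * z i) ^ 2 → (k, l, z) ∈ N' := by
        intro k l z hk hl hz hbig
        refine Finset.mem_filter.2 ⟨?_, hk, hbig⟩
        refine Finset.mem_product.2 ⟨mem_Icc_of_abs_le hk, Finset.mem_product.2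
          ⟨mem_Icc_of_abs_le hl, mem_integerBall.2 ?_⟩⟩
        rw [hγδ] at hz
        exact Nat.le_floor hz
      have hcc : (η + 13 * η + 6 * η) * √(n : ℝ) = c * √(n : ℝ) := by rw [hc]; ring
      rcases hP with hP | hP
      · obtain ⟨k, l, z, hk, hl, hz, hbig, hfin⟩ := exists_netVector hn hδ0 hδ1 hη0.le (by linarith)
          hη0 hη (by linarith) hent hgood.1 hx hP
        rw [hcc] at hfin
        exact Finset.mem_union_right _ (Finset.mem_biUnion.2 ⟨(k, l, z), hmemN k l z hk hl hz hbig,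
          Finset.mem_union_left _ (Finset.mem_filter.2 ⟨hPS, hfin⟩)⟩)
      · obtain ⟨k, l, z, hk, hl, hz, hbig, hfin⟩ := exists_netVector hn hδ0 hδ1 hη0.le (by linarith)
          hη0 hη (by linarith) (fun i j => hent j i) hgood.2 hx hP
        rw [hcc] at hfin
        exact Finset.mem_union_right _ (Finset.mem_biUnion.2 ⟨(k, l, z), hmemN k l z hk hl hz hbig,
          Finset.mem_union_right _ (Finset.mem_filter.2 ⟨hPS, hfin⟩)⟩)
    · exact Finset.mem_union_left _ (Finset.mem_filter.2 ⟨hPS, hgood⟩)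
  set C := (n.choose (n / 2) : ℝ) ^ n with hC
  have hC0 : 0 ≤ C := by positivity
  have hqn : 0 ≤ q ^ n := pow_nonneg (by linarith) n
  have hEc : ∀ y ∈ N', ((E y).card : ℝ) ≤ C * (4 * Real.exp (3 / 10 * σ * n) * q ^ n) := by
    intro y hy
    obtain ⟨hyN, hk, hbig⟩ := Finset.mem_filter.1 hy
    have hz : y.2.2 ∈ integerBall n K :=
      (Finset.mem_product.1 (Finset.mem_product.1 hyN).2).2
    have htc : t * c ^ 2 ≤ σ / 10 := by rw [hc]; linarith
    have hγσ : γ ≤ σ / 10 := by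
      refine le_trans ?_ hγβ
      rw [le_div_iff₀ hβ0]
      nlinarith
    have h1 := card_mulVec_netVector_small_le (δ := δ) (η := η) (σ := 3 / 10 * σ) (c := c)
      (by omega) ht (by linarith) hq
      (by linarith) hKγ (by linarith) y.1 y.2.1 hz hbig
    have h2 := card_vecMul_netVector_small_le (δ := δ) (η := η) (σ := 3 / 10 * σ) (c := c)
      (by omega) ht hq0 hq hη0
      (by linarith) hγ hβ0 hβ1 hKγ (by linarith) hk y.2.1 hz hbig
    refine (Nat.cast_le.2 (Finset.card_union_le _ _)).trans ?_
    push_cast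
    linarith
  have hNc : (N'.card : ℝ) ≤ (6 / η + 3) * ((2 / η + 3) * n) * Real.exp (σ / 5 * n) := by
    refine (Nat.cast_le.2 (Finset.card_filter_le _ _)).trans ?_
    rw [hN, Finset.card_product, Finset.card_product]
    push_cast
    rw [← mul_assoc]
    have h1 := card_Icc_floor_le (B := 3 / η + 1) (by positivity)
    have h2 := card_Icc_floor_le (B := √(n : ℝ) / η + 1) (by positivity)
    have h3 : √(n : ℝ) ≤ n := by
      rw [Real.sqrt_le_left (by positivity)]
      nlinarith
    have h4 : 2 * (√(n : ℝ) / η + 1) + 1 ≤ (2 / η + 3) * n := by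
      have : √(n : ℝ) / η ≤ n / η := div_le_div_of_nonneg_right h3 hη0.le
      have e : (2 / η + 3) * n = 2 * (n / η) + 3 * n := by ring
      rw [e]
      linarith
    have h5 : ((integerBall n K).card : ℝ) ≤ Real.exp (σ / 5 * n) := by
      refine (card_integerBall_le hr0 hr2 n K).trans ?_
      have e1 : (1 / r) ^ K ≤ Real.exp (σ / 10 * n) := by
        have : 1 / r ≤ Real.exp (1 / r) := by linarith [Real.add_one_le_exp (1 / r)]
        refine (pow_le_pow_left₀ (by positivity) this K).trans ?_
        rw [← Real.exp_nat_mul, Real.exp_le_exp]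
        calc (K : ℝ) * (1 / r) ≤ γ * n * (1 / r) :=
              mul_le_mul_of_nonneg_right hKγ (by positivity)
          _ = γ / r * n := by ring
          _ ≤ _ := mul_le_mul_of_nonneg_right hγr (by positivity)
      have e2 : (1 + 4 * r) ^ n ≤ Real.exp (σ / 10 * n) := by
        have : 1 + 4 * r ≤ Real.exp (σ / 10) := by linarith [Real.add_one_le_exp (σ / 10)]
        refine (pow_le_pow_left₀ (by positivity) this n).trans_eq ?_
        rw [← Real.exp_nat_mul, mul_comm]
      refine (mul_le_mul e1 e2 (by positivity) (Real.exp_pos _).le).trans_eq ?_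
      rw [← Real.exp_add]
      congr 1
      ring
    have h1' : ((Finset.Icc (-(⌊3 / η + 1⌋₊ : ℤ)) ⌊3 / η + 1⌋₊).card : ℝ) ≤ 6 / η + 3 :=
      h1.trans_eq (by ring)
    exact mul_le_mul (mul_le_mul h1' (h2.trans h4) (by positivity) (by positivity)) h5
      (by positivity) (by positivity)
  have hp : (q * Real.exp σ) ^ n = q ^ n * Real.exp (σ * n) := by
    rw [mul_pow, ← Real.exp_nat_mul, mul_comm (n : ℝ)]
  have hDc : (D.card : ℝ) ≤ C * (1 / 2 * (q * Real.exp σ) ^ n) := by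
    refine (card_not_signBounded_le (by omega)).trans ?_
    refine mul_le_mul_of_nonneg_left (four_mul_pow_le_half_mul_pow (by omega) ?_) hC0
    have := Real.one_le_exp hσ.le
    nlinarith
  -- the polynomial factor is absorbed through `exp (σ n / 2) ≥ (σ n / 2) ^ 2 / 2`
  have hpoly : 8 * ((6 / η + 3) * ((2 / η + 3) * n)) ≤ Real.exp (σ / 2 * n) := by
    have h1 := Real.quadratic_le_exp_of_nonneg (x := σ / 2 * n) (by positivity)
    have h2 : 8 * ((6 / η + 3) * ((2 / η + 3) * n)) ≤ (σ / 2 * n) ^ 2 / 2 := by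
      have := mul_le_mul_of_nonneg_right hnσ (by positivity : (0 : ℝ) ≤ n / 8)
      calc _ = 64 * (6 / η + 3) * (2 / η + 3) * (n / 8) := by ring
        _ ≤ _ := this
        _ = _ := by ring
    have h3 : 0 ≤ σ / 2 * n := by positivity
    linarith
  have hUc : ((N'.biUnion E).card : ℝ) ≤ C * (1 / 2 * (q * Real.exp σ) ^ n) := by
    calc ((N'.biUnion E).card : ℝ) ≤ ∑ y ∈ N', ((E y).card : ℝ) := by
          exact_mod_cast Finset.card_biUnion_le
      _ ≤ ∑ _y ∈ N', C * (4 * Real.exp (3 / 10 * σ * n) * q ^ n) := Finset.sum_le_sum hEc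
      _ = N'.card * (C * (4 * Real.exp (3 / 10 * σ * n) * q ^ n)) := by
          rw [Finset.sum_const, nsmul_eq_mul]
      _ ≤ ((6 / η + 3) * ((2 / η + 3) * n) * Real.exp (σ / 5 * n)) *
          (C * (4 * Real.exp (3 / 10 * σ * n) * q ^ n)) :=
          mul_le_mul_of_nonneg_right hNc (by positivity)
      _ = (8 * ((6 / η + 3) * ((2 / η + 3) * n))) * (C * (1 / 2 *
          (Real.exp (σ / 5 * n) * Real.exp (3 / 10 * σ * n)) * q ^ n)) := by ring
      _ ≤ Real.exp (σ / 2 * n) * (C * (1 / 2 *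
          (Real.exp (σ / 5 * n) * Real.exp (3 / 10 * σ * n)) * q ^ n)) :=
          mul_le_mul_of_nonneg_right hpoly (by positivity)
      _ = C * (1 / 2 * (q ^ n * (Real.exp (σ / 2 * n) *
          (Real.exp (σ / 5 * n) * Real.exp (3 / 10 * σ * n))))) := by ring
      _ = _ := by
          rw [hp, ← Real.exp_add, ← Real.exp_add]
          congr 5
          ring
  refine (Nat.cast_le.2 ((Finset.card_le_card hsub).trans (Finset.card_union_le _ _))).trans ?_
  push_cast
  linarith

/-! ### Transfer to the law of the random matrix -/

/-- The `0`-`1` vector of a Boolean word. -/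
noncomputable def bitVector {n : ℕ} (q : Fin n → Bool) : Fin n → ℝ :=
  fun j => halfSign (q j) + 1 / 2

lemma bitVector_injective {n : ℕ} : Function.Injective (bitVector (n := n)) := by
  intro q q' h
  funext j
  have hj := congrFun h j
  simp only [bitVector, halfSign] at hj
  revert hj
  cases q j <;> cases q' j <;> norm_num

lemma booleanSlice_eq_image (n m : ℕ) [DecidableEq (Fin n → ℝ)] :
    booleanSlice n m = ((sliceWords n m).image bitVector : Finset (Fin n → ℝ)) := by
  ext v
  simp only [Finset.coe_image, Set.mem_image, Finset.mem_coe]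
  constructor
  · rintro ⟨h1, h2⟩
    have hv : bitVector (fun j => decide (v j = 1)) = v := by
      funext j
      rcases h1 j with h | h <;> norm_num [bitVector, halfSign, h]
    refine ⟨fun j => decide (v j = 1), ?_, hv⟩
    simp only [sliceWords, Finset.mem_filter, Finset.mem_univ, true_and, decide_eq_true_eq]
    have : ∀ j, v j = if v j = 1 then 1 else 0 := by
      intro j
      rcases h1 j with h | h <;> simp [h]
    rw [Finset.sum_congr rfl fun j _ => this j, Finset.sum_boole] at h2
    exact_mod_cast h2
  · rintro ⟨q, hq, rfl⟩
    refine ⟨fun j => ?_, ?_⟩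
    · cases h : q j <;> norm_num [bitVector, halfSign, h]
    · simp only [bitVector]
      rw [Finset.sum_add_distrib, sum_halfSign_of_mem_sliceWords hq]
      simp
      ring

/-- The law of the random matrix is dominated by the counting of slice matrices. No measurability
of the event is needed. -/
lemma rowSliceLaw_le {n : ℕ} (E : Set (Fin n → Fin n → ℝ)) (M : Finset (Fin n → Fin n → Bool))
    (hM : ∀ P ∈ sliceMatrices n, (fun i => bitVector (P i)) ∈ E → P ∈ M)
    (hMS : M ⊆ sliceMatrices n) :
    rowSliceLaw n E ≤ (M.card : ENNReal) * ((n.choose (n / 2) : ENNReal)⁻¹) ^ n := by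
  classical
  set S := booleanSlice n (n / 2) with hS
  have hSi : S = ((sliceWords n (n / 2)).image bitVector : Finset (Fin n → ℝ)) :=
    booleanSlice_eq_image n (n / 2)
  have hsing : ∀ q ∈ sliceWords n (n / 2),
      uniformOn S {bitVector q} = (n.choose (n / 2) : ENNReal)⁻¹ := by
    intro q hq
    have h := uniformOn_apply_finset (s := (sliceWords n (n / 2)).image bitVector)
      (t := {bitVector q})
    rw [Finset.coe_singleton, ← hSi, Finset.inter_singleton_of_mem (Finset.mem_image_of_mem _ hq),
      Finset.card_singleton, Finset.card_image_of_injective _ bitVector_injective,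
      card_sliceWords] at h
    rw [h]
    simp
  have hae : ∀ᵐ Q ∂rowSliceLaw n, ∀ i, Q i ∈ S := by
    rw [ae_all_iff]
    intro i
    have hi : ∀ᵐ v ∂(uniformOn S), v ∈ S := by
      have hfin : S.Finite := by rw [hSi]; exact Finset.finite_toSet _
      exact ae_cond_mem hfin.measurableSet
    exact (Measure.tendsto_eval_ae_ae (μ := fun _ : Fin n => uniformOn S) (i := i)).eventually hi
  have hE : rowSliceLaw n E = rowSliceLaw n (E ∩ {Q | ∀ i, Q i ∈ S}) :=
    (measure_inter_conull (mem_ae_iff.1 hae)).symm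
  rw [hE]
  have hsub : E ∩ {Q | ∀ i, Q i ∈ S} ⊆
      ⋃ P ∈ M, {fun i => bitVector (P i)} := by
    rintro Q ⟨hQE, hQ⟩
    have hex : ∀ i, ∃ q ∈ sliceWords n (n / 2), bitVector q = Q i := by
      intro i
      have := hQ i
      rw [hSi] at this
      simpa using this
    choose P hP hPQ using hex
    have hPQ' : (fun i => bitVector (P i)) = Q := funext hPQ
    refine Set.mem_iUnion₂.2 ⟨P, hM P (Fintype.mem_piFinset.2 hP) ?_, hPQ'.symm⟩
    rwa [hPQ']
  refine (measure_mono hsub).trans ((measure_biUnion_finset_le _ _).trans ?_)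
  rw [← nsmul_eq_mul]
  refine Finset.sum_le_card_nsmul _ _ _ fun P hP => ?_
  have hPS := Fintype.mem_piFinset.1 (hMS hP)
  rw [rowSliceLaw, Measure.pi_singleton, Finset.prod_congr rfl fun i _ => hsing (P i) (hPS i)]
  simp

lemma almostConstant_nonempty {n : ℕ} (hn : 0 < n) {δ ρ : ℝ} (hδ : 0 ≤ δ) (hρ : 0 ≤ ρ) :
    (almostConstant n δ ρ).Nonempty := by
  have hn0 : (0 : ℝ) < n := by exact_mod_cast hn
  have hs : 0 < √(n : ℝ) := Real.sqrt_pos.2 hn0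
  refine ⟨WithLp.toLp 2 ((1 / √(n : ℝ)) • 1), ?_, 1 / √(n : ℝ), ?_⟩
  · change euclNorm _ = 1
    rw [euclNorm_smul, euclNorm_one, abs_of_pos (by positivity)]
    field_simp
  · have : ({i : Fin n | |(WithLp.toLp 2 ((1 / √(n : ℝ)) • (1 : Fin n → ℝ)) :
        EuclideanSpace ℝ (Fin n)) i - 1 / √(n : ℝ)| ≤ ρ / √(n : ℝ)} : Set (Fin n)) = Set.univ := by
      ext i
      simp only [Set.mem_ofPred_eq, Set.mem_univ, iff_true]
      simp
      positivity
    rw [this, Set.ncard_univ, Nat.card_eq_fintype_card, Fintype.card_fin]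
    nlinarith

lemma mulVecNorm_bitVector {n : ℕ} (P : Fin n → Fin n → Bool) (x : EuclideanSpace ℝ (Fin n)) :
    mulVecNorm (Matrix.of fun i => bitVector (P i)) x =
      euclNorm (centredMatrix P *ᵥ x.ofLp + (1 / 2 * ∑ i, x i) • 1) := by
  rw [mulVecNorm, euclNorm]
  congr 2
  funext i
  rw [Pi.add_apply, centredMatrix_mulVec]
  simp only [Matrix.mulVec, dotProduct, Matrix.of_apply, bitVector, Pi.smul_apply, Pi.one_apply,
    smul_eq_mul, mul_one, Finset.mul_sum, ← Finset.sum_add_distrib]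
  exact Finset.sum_congr rfl fun j _ => by ring

lemma vecMulNorm_bitVector {n : ℕ} (P : Fin n → Fin n → Bool) (y : EuclideanSpace ℝ (Fin n)) :
    vecMulNorm (Matrix.of fun i => bitVector (P i)) y =
      euclNorm ((centredMatrix P)ᵀ *ᵥ y.ofLp + (1 / 2 * ∑ i, y i) • 1) := by
  rw [vecMulNorm, euclNorm]
  congr 2
  funext j
  rw [Pi.add_apply, centredMatrix_transpose_mulVec]
  simp only [Matrix.vecMul, dotProduct, Matrix.of_apply, bitVector, Pi.smul_apply, Pi.one_apply,
    smul_eq_mul, mul_one, Finset.mul_sum, ← Finset.sum_add_distrib]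
  exact Finset.sum_congr rfl fun i _ => by ring

theorem proposition6p1 (ε : ℝ) (hε : 0 < ε) :
    ∃ δ ρ c : ℝ, δ ∈ Set.Ioo (0 : ℝ) 1 ∧ ρ ∈ Set.Ioo (0 : ℝ) 1 ∧ 0 < c ∧
      ∃ n₀ : ℕ, ∀ n : ℕ, n₀ ≤ n →
        rowSliceLaw n
          {Q | (⨅ x : almostConstant n δ ρ, mulVecNorm (Matrix.of Q) x) ≤ c * √(n : ℝ) ∨
            (⨅ y : almostConstant n δ ρ, vecMulNorm (Matrix.of Q) y) ≤ c * √(n : ℝ)}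
          ≤ ENNReal.ofReal ((1 / 2 + ε) ^ n) := by
  classical
  -- the slack `σ` between the constant `1 / 2 + ε / 2` of the small ball estimates and `1 / 2 + ε`
  -- pays for the net, the change of density and the exponential Markov inequality
  set q : ℝ := 1 / 2 + ε / 2 with hq
  have hq0 : 0 < q := by positivity
  set σ : ℝ := Real.log ((1 / 2 + ε) / q) with hσdef
  have hratio : 1 < (1 / 2 + ε) / q := by
    rw [lt_div_iff₀ hq0]
    linarith
  have hσ : 0 < σ := Real.log_pos hratio
  have hqσ : q * Real.exp σ = 1 / 2 + ε := by
    rw [hσdef, Real.exp_log (by linarith)]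
    field_simp
  obtain ⟨t, ht, hanti⟩ := exists_sum_exp_neg_sq_le (κ := 1 / 4096) (ε := ε / 2) (by norm_num)
    (by positivity)
  set η : ℝ := min (1 / 32) (σ / (4000 * t)) with hη
  have hη0 : 0 < η := lt_min (by norm_num) (by positivity)
  have hη1 : η ≤ 1 / 32 := min_le_left _ _
  have hηt : 400 * t * η ^ 2 ≤ σ / 10 := by
    have h1 : η * (4000 * t) ≤ σ := (le_div_iff₀ (by positivity)).1 (min_le_right _ _)
    have h2 : η ^ 2 ≤ η := by nlinarith
    have h3 : 400 * t * η ^ 2 ≤ 400 * t * η := mul_le_mul_of_nonneg_left h2 (by positivity)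
    linarith
  set β : ℝ := min 1 (σ / 10) with hβ
  have hβ0 : 0 < β := lt_min one_pos (by positivity)
  set r : ℝ := min (1 / 2) (σ / 40) with hr
  have hr0 : 0 < r := lt_min (by norm_num) (by positivity)
  set γ : ℝ := min (1 / 65536) (min (β * σ / 20) (r * σ / 10)) with hγ
  have hγ0 : 0 < γ := lt_min (by norm_num) (lt_min (by positivity) (by positivity))
  have hγ1 : γ ≤ 1 / 65536 := min_le_left _ _
  have hγβ : 2 * γ / β ≤ σ / 10 := by
    have : γ ≤ β * σ / 20 := (min_le_right _ _).trans (min_le_left _ _)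
    rw [div_le_iff₀ hβ0]
    linarith
  have hγr : γ / r ≤ σ / 10 := by
    have : γ ≤ r * σ / 10 := (min_le_right _ _).trans (min_le_right _ _)
    rw [div_le_iff₀ hr0]
    linarith
  have hrσ : 4 * r ≤ σ / 10 := by
    have : r ≤ σ / 40 := min_le_right _ _
    linarith
  set δ : ℝ := γ * η ^ 2 / 10 with hδ
  have hδ0 : 0 < δ := by positivity
  have hδ1 : δ < 1 := by
    have : γ * η ^ 2 ≤ 1 * 1 :=
      mul_le_mul (by linarith) (by nlinarith) (sq_nonneg _) (by norm_num)
    rw [hδ]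
    linarith
  obtain ⟨n₁, hn₁⟩ := exists_nat_ge (64 * (6 / η + 3) * (2 / η + 3) / σ ^ 2)
  refine ⟨δ, η, η / 2, ⟨hδ0, hδ1⟩, ⟨hη0, by linarith⟩, by positivity, max 10000 n₁, ?_⟩
  intro n hn
  have hn2 : 10000 ≤ n := (le_max_left _ _).trans hn
  have hn0 : 0 < n := by omega
  have hnσ : 64 * (6 / η + 3) * (2 / η + 3) ≤ σ ^ 2 * n := by
    rw [div_le_iff₀ (by positivity)] at hn₁
    have : (n₁ : ℝ) ≤ n := Nat.cast_le.2 ((le_max_right _ _).trans hn)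
    nlinarith [sq_nonneg σ]
  have hcount := card_nearlySingular_le hn2 ht.le (by linarith) hanti hσ hη0 hη1 hηt hβ0
    (min_le_left _ _) (min_le_right _ _) hr0 (min_le_left _ _) hrσ hγ0 hγ1 hγβ hγr hnσ
  rw [hqσ] at hcount
  have : Nonempty (almostConstant n δ η) :=
    (almostConstant_nonempty hn0 hδ0.le hη0.le).to_subtype
  have hlt : η / 2 * √(n : ℝ) < η * √(n : ℝ) := by
    have : 0 < √(n : ℝ) := Real.sqrt_pos.2 (by exact_mod_cast hn0)
    nlinarith
  set M := (sliceMatrices n).filter (NearlySingular δ η η) with hM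
  refine (rowSliceLaw_le _ M (fun P hPS hP => ?_) (Finset.filter_subset _ _)).trans ?_
  · refine Finset.mem_filter.2 ⟨hPS, ?_⟩
    -- the infimum need not be attained, hence the factor `2` between the two thresholds
    rcases hP with hP | hP
    · obtain ⟨x, hx⟩ := exists_lt_of_ciInf_lt (hP.trans_lt hlt)
      rw [mulVecNorm_bitVector] at hx
      exact ⟨x, x.2, Or.inl hx.le⟩
    · obtain ⟨x, hx⟩ := exists_lt_of_ciInf_lt (hP.trans_lt hlt)
      rw [vecMulNorm_bitVector] at hx
      exact ⟨x, x.2, Or.inr hx.le⟩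
  have hCpos : 0 < n.choose (n / 2) := Nat.choose_pos (Nat.div_le_self n 2)
  have hC : (0 : ℝ) < n.choose (n / 2) := by exact_mod_cast hCpos
  calc (M.card : ENNReal) * ((n.choose (n / 2) : ENNReal)⁻¹) ^ n
      = ENNReal.ofReal (M.card * ((n.choose (n / 2) : ℝ)⁻¹) ^ n) := by
        rw [ENNReal.ofReal_mul (by positivity), ENNReal.ofReal_natCast,
          ENNReal.ofReal_pow (by positivity), ENNReal.ofReal_inv_of_pos hC,
          ENNReal.ofReal_natCast]
    _ ≤ _ := by
        refine ENNReal.ofReal_le_ofReal ?_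
        rw [inv_pow, ← div_eq_mul_inv, div_le_iff₀ (by positivity), mul_comm]
        exact hcount
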